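/- **Setting.** Let $G$ be a finite connected weighted undirected multigraph (loops and parallel edges allowed) with vertex set $V$ and positive edge weights, and let $A=(a_{uv})_{u,v\in V}$ be its weighted adjacency matrix: $a_{uv}$ is the sum of the weights of all edges joining $u$ and $v$. Let $\rho(\cdot)$ denote the spectral radius. For $t>0$ let $tG$ be $G$ with all edge weights multiplied by $t$. A walk is an alternating sequence of vertices and edges $v_0,e_1,v_1,\dots,e_m,v_m$ where $e_k$ joins $v_{k-1}$ and $v_k$; its length is $m$ and its weight is the product of its $m$ edge weights ($1$ if $m=0$). For $0<t<\rho(A)^{-1}$ let $r_{uv}(t)$ be the total weight of all $u\to v$ walks in $tG$ and let $$d_t(u,v)=\tfrac12\bigl(\ln r_{uu}(t)+\ln r_{vv}(t)-\ln r_{uv}(t)-\ln r_{vu}(t)\bigr)$$ be the walk distance. Fix two distinct vertices $i,j$. **Circuits.** A *circuit* is a class of closed walks of non-zero length under cyclic shifts, where a walk is read as the sequence of its directed edge traversals (a loop has one traversal). Its multiplicity $\mu$ is the greatest $m$ such that its walks are $m$-fold repetitions of a closed walk; its weight and number of arcs are the weight and the length of its walks. **Alternating routes with jumps.** Attach to $tG$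 two additional loops of weight $1$, one at $i$ and one at $j$, called *jumps*. For $a,b\in\{i,j\}$, an *alternating walk with jumps* from $a$ to $b$ is an $a\to b$ walk in the resulting graph such that every $j\dots j$ subwalk visits $i$ or contains no edges except for jumps, and every $i\dots i$ subwalk visits $j$ or contains no edges except for jumps. Cutting it at every visit to $i$ or $j$ gives pieces $\omega_1,\dots,\omega_s$, each of which is a single jump or is an $i\to j$ or $j\to i$ walk without jumps that meets $\{i,j\}$ only at its ends. Let $p_k=\{\omega_k,\tilde\omega_k\}$, where $\tilde\omega_k$ is $\omega_k$ reversed if $\omega_k$ contains no jump, and is the jump at the other one of the vertices $i,j$ if $\omega_k$ is a jump. Two alternating walks with jumps from $a$ to $b$ are equivalent if their sequences $(p_1,\dots,p_s)$ agree up to a cyclic shift. An equivalence class is called an *alternating $a\to b$ route with jumps* if $a\ne b$, and an *alternating $a\to b'\to a$ route with jumps* if $a=b$, where $b'$ is the other one of the vertices $i,j$ (it need not be visited). Its weight and number of arcs are the weight and length (jumps included) of any of its walks, and its multiplicity $\mu$ is the number of repetitions of the elementary repeating part of $(p_1,\dots,p_s)$. **Series.** Let $\mathcal C^{i\bar j}$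 (resp. $\mathcal C^{\bar i j}$) be the set of circuits in $tG$ visiting $i$ but not $j$ (resp. $j$ but not $i$), let $\mathcal C^{+}$ be the set of alternating $j\to i\to j$ and $i\to j\to i$ routes with jumps in $tG$, and let $\mathcal C^{-}$ be the set of alternating $j\to i$ and $i\to j$ routes with jumps in $tG$. Let $\mathcal C_k$ be the set of those of these figures that involve $k$ arcs, and put $\zeta(c)=0$ for $c\in\mathcal C^{+}$ and $\zeta(c)=1$ for $c\in\mathcal C^{i\bar j}\cup\mathcal C^{\bar i j}\cup\mathcal C^{-}$. Let $\mathcal A$ be the matrix with rows and columns indexed by $V\setminus\{i\}$ that is obtained from $tA$ by replacing the entry $ta_{ji}$ with $ta_{ji}-1$, deleting row $i$, multiplying column $i$ by $-1$, and putting it in the place of column $j$. **Theorem.** Let $0<t<\rho(A)^{-1}$. If $\rho(\mathcal A)<1$, then the following series over $k$ converges and $$d_t(i,j)=\frac12\sum_{k=1}^\infty\ \sum_{c\in(\mathcal C^{i\bar j}\cup\mathcal C^{\bar i j}\cup\mathcal C^{+}\cup\mathcal C^{-})\cap\mathcal C_k}(-1)^{\zeta(c)}\,\frac{w(c)}{\mu(c)}.$$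 Moreover, this equality holds whenever the series on the right converges. -/

import Mathlib

open Filter Topology

noncomputable section

namespace WalkDist

/-! ### Walks in weighted multigraphs

A weighted multigraph is a `Graph V E` (parallel edges and loops are allowed) together with a
weight function `w : E → ℝ`; multiplying all weights by `t` replaces `w` by `fun e => t * w e`. -/

/-- A traversal of an edge from `src` to `tgt`. A loop has only one traversal. -/
structure Arc (V E : Type*) where
  src : V
  edge : E
  tgt : V

/-- The list of arcs `l` is a walk from `u` to `v` in `G`. -/
def IsWalk {V E : Type*} (G : Graph V E) : V → List (Arc V E) → V → Prop
  | u, [], v => u ∈ G.vertexSet ∧ u = v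
  | u, a :: l, v => a.src = u ∧ G.IsLink a.edge a.src a.tgt ∧ IsWalk G a.tgt l v

/-- The product of the weights of the edges of a walk. -/
def walkProd {V E : Type*} (w : E → ℝ) (l : List (Arc V E)) : ℝ :=
  (l.map fun a => w a.edge).prod

/-- The sequence of arcs `l` visits the vertex `v`. -/
def Visits {V E : Type*} (l : List (Arc V E)) (v : V) : Prop :=
  ∃ a ∈ l, a.src = v ∨ a.tgt = v

/-- Every two vertices are joined by a walk. -/
def IsConnected {V E : Type*} (G : Graph V E) : Prop :=
  ∀ u ∈ G.vertexSet, ∀ v ∈ G.vertexSet, ∃ l, IsWalk G u l v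

/-- The entry `r_{uv}` of the matrix of the walk weights: the total weight of all walks from `u`
to `v`. -/
def walkWeight {V E : Type*} (G : Graph V E) (w : E → ℝ) (u v : V) : ℝ :=
  ∑' l : {l : List (Arc V E) // IsWalk G u l v}, walkProd w l.1

/-- The walk distance `d_t(i, j)`. -/
def walkDist {V E : Type*} (G : Graph V E) (w : E → ℝ) (t : ℝ) (i j : V) : ℝ :=
  let h : V → V → ℝ := fun u v => Real.log (walkWeight G (fun e => t * w e) u v)
  (1 / 2) * (h i i + h j j - h i j - h j i)

open Classical in
/-- The weighted adjacency matrix `A`. -/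
def adjMatrix {V E : Type*} [Fintype E] (G : Graph V E) (w : E → ℝ) : Matrix V V ℝ :=
  Matrix.of fun u v => ∑ e : E, if G.IsLink e u v then w e else 0

open Classical in
/-- The spectral radius of a real square matrix (over its complex eigenvalues). -/
def specRadius {ι : Type*} [Fintype ι] (M : Matrix ι ι ℝ) : ENNReal :=
  spectralRadius ℂ (M.map (fun x : ℝ => (x : ℂ)))

open Classical in
/-- The matrix obtained from `M` by subtracting `1` from the entry `(j, i)`, deleting row `i`,
multiplying column `i` by `-1` and moving it into the position of column `j`. -/
def reducedMatrix {V : Type*} (M : Matrix V V ℝ) (i j : V) : Matrix {v // v ≠ i} {v // v ≠ i} ℝ :=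
  Matrix.of fun u v =>
    if v.1 = j then -(M u.1 i - if u.1 = j then 1 else 0) else M u.1 v.1

/-! ### Cyclic words and circuits -/

/-- The greatest `m` such that the cyclic word `c` is the `m`-fold repetition of some word. -/
def cyclicMultiplicity {α : Type*} (c : Cycle α) : ℕ :=
  sSup {m : ℕ | ∃ s : List α, (((List.replicate m s).flatten : List α) : Cycle α) = c}

/-- A circuit: a closed walk of non-zero length up to a cyclic shift. -/
def Circuit {V E : Type*} (G : Graph V E) : Type _ :=
  {c : Cycle (Arc V E) // ∃ v l, l ≠ [] ∧ IsWalk G v l v ∧ (l : Cycle (Arc V E)) = c}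

namespace Circuit

variable {V E : Type*} {G : Graph V E}

/-- The number of arcs of a circuit. -/
def length (c : Circuit G) : ℕ := c.1.length

/-- The product of the edge weights along a circuit. -/
def weight (w : E → ℝ) (c : Circuit G) : ℝ := (c.1.toMultiset.map fun a => w a.edge).prod

/-- The multiplicity of a circuit. -/
def multiplicity (c : Circuit G) : ℕ := cyclicMultiplicity c.1

/-- The circuit `c` visits the vertex `v`. -/
def Visits (c : Circuit G) (v : V) : Prop := ∃ a ∈ c.1, a.src = v ∨ a.tgt = v

end Circuit

/-! ### Alternating routes with jumps -/

/-- The graph obtained from `G` by attaching one additional loop at `i` and one at `j`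
(the jumps `Sum.inr i` and `Sum.inr j`). -/
def addJumps {V E : Type*} (G : Graph V E) (i j : V) : Graph V (E ⊕ V) where
  vertexSet := G.vertexSet ∪ {i, j}
  IsLink e x y := match e with
    | Sum.inl e => G.IsLink e x y
    | Sum.inr v => (v = i ∨ v = j) ∧ x = v ∧ y = v
  isLink_symm := by
    rintro (e | v) -
    · exact ⟨fun x y h => h.symm⟩
    · exact ⟨fun x y h => ⟨h.1, h.2.2, h.2.1⟩⟩
  eq_or_eq_of_isLink_of_isLink := by
    rintro (e | v) x y a b h h'
    · exact G.eq_or_eq_of_isLink_of_isLink h h'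
    · exact Or.inl (h.2.1.trans h'.2.1.symm)
  left_mem_of_isLink := by
    rintro (e | v) x y h
    · exact Or.inl (G.left_mem_of_isLink h)
    · obtain ⟨h1, rfl, -⟩ := h
      exact Or.inr h1

/-- Edge weights in the graph with jumps: the jumps have weight `1`. -/
def jumpWeight {V E : Type*} (w : E → ℝ) : E ⊕ V → ℝ := Sum.elim w fun _ => 1

/-- `l` is an alternating walk with `i, j` jumps from `a` to `b`: every `j … j` subwalk visits `i`
or contains no edges except for jumps, and every `i … i` subwalk visits `j` or contains no edges
except for jumps. -/
def IsAlternating {V E : Type*} (G : Graph V E) (i j a b : V) (l : List (Arc V (E ⊕ V))) : Prop :=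
  IsWalk (addJumps G i j) a l b ∧
  (∀ s, s <:+: l → IsWalk (addJumps G i j) j s j →
    Visits s i ∨ ∀ x ∈ s, x.edge.isRight = true) ∧
  (∀ s, s <:+: l → IsWalk (addJumps G i j) i s i →
    Visits s j ∨ ∀ x ∈ s, x.edge.isRight = true)

open Classical in
/-- Reverses an arc of the original graph and exchanges the jump at `i` with the jump at `j`. -/
def mateArc {V E : Type*} (i j : V) : Arc V (E ⊕ V) → Arc V (E ⊕ V)
  | ⟨x, Sum.inl e, y⟩ => ⟨y, Sum.inl e, x⟩
  | ⟨_, Sum.inr v, _⟩ => ⟨Equiv.swap i j v, Sum.inr (Equiv.swap i j v), Equiv.swap i j v⟩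

/-- The mate of a piece of an alternating walk: a walk without jumps is written from end to
beginning, and the jump walk at `i` (at `j`) becomes the jump walk at `j` (at `i`). -/
def mate {V E : Type*} (i j : V) (l : List (Arc V (E ⊕ V))) : List (Arc V (E ⊕ V)) :=
  (l.map (mateArc i j)).reverse

open Classical in
/-- The pieces of an alternating walk with jumps: it is cut at every visit to `i` or `j`, so that
each piece is a jump walk or a hitting walk without jumps between `i` and `j`. -/
def pieces {V E : Type*} (i j : V) (l : List (Arc V (E ⊕ V))) : List (List (Arc V (E ⊕ V))) :=
  l.splitBy fun a _ => decide (a.tgt ≠ i ∧ a.tgt ≠ j)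

/-- The route partition: the sequence of the unordered pairs of a piece and its mate. -/
def routePartition {V E : Type*} (i j : V) (l : List (Arc V (E ⊕ V))) :
    List (Sym2 (List (Arc V (E ⊕ V)))) :=
  (pieces i j l).map fun p => s(p, mate i j p)

/-- Two alternating walks with jumps are equipartite if their route partitions agree up to a
cyclic shift. -/
def equipartite {V E : Type*} (G : Graph V E) (i j a b : V) :
    Setoid {l : List (Arc V (E ⊕ V)) // IsAlternating G i j a b l} where
  r l l' := routePartition i j l.1 ~r routePartition i j l'.1
  iseqv := ⟨fun _ => List.IsRotated.refl _, List.IsRotated.symm, List.IsRotated.trans⟩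

/-- An alternating route with `i, j` jumps from `a` to `b`: a class of equipartite alternating
walks with jumps. For `a = j` and `b = i` this is an alternating `j → i` route with jumps, for
`a = b = j` an alternating `j → i → j` route with jumps. -/
def Route {V E : Type*} (G : Graph V E) (i j a b : V) : Type _ :=
  Quotient (equipartite G i j a b)

theorem walkProd_mate {V E : Type*} (w : E → ℝ) (i j : V) (l : List (Arc V (E ⊕ V))) :
    walkProd (jumpWeight w) (mate i j l) = walkProd (jumpWeight w) l := by
  have h : (fun a => jumpWeight w (mateArc i j a).edge) =
      fun a : Arc V (E ⊕ V) => jumpWeight w a.edge := by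
    funext a
    rcases a with ⟨x, e | v, y⟩ <;> rfl
  simp only [walkProd, mate, List.map_reverse, List.prod_reverse, List.map_map]
  exact congrArg (fun f => (l.map f).prod) h

theorem walkProd_flatten {V E : Type*} (w : E → ℝ) (L : List (List (Arc V E))) :
    walkProd w L.flatten = (L.map (walkProd w)).prod := by
  induction L with
  | nil => simp [walkProd]
  | cons l L ih =>
    rw [List.flatten_cons, List.map_cons, List.prod_cons, ← ih]
    simp only [walkProd, List.map_append, List.prod_append]

theorem walkProd_eq_of_equipartite {V E : Type*} (w : E → ℝ) (i j : V)
    (l l' : List (Arc V (E ⊕ V))) (h : routePartition i j l ~r routePartition i j l') :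
    walkProd (jumpWeight w) l = walkProd (jumpWeight w) l' := by
  let f : Sym2 (List (Arc V (E ⊕ V))) → ℝ :=
    Sym2.lift ⟨fun a b => (walkProd (jumpWeight w) a + walkProd (jumpWeight w) b) / 2,
      fun a b => by simp only [add_comm]⟩
  have key : ∀ l, ((routePartition i j l).map f).prod = walkProd (jumpWeight w) l := by
    intro l
    have hf : (f ∘ fun p => s(p, mate i j p)) = walkProd (jumpWeight w) := by
      funext p
      simp [f, walkProd_mate]
    rw [routePartition, List.map_map, hf, ← walkProd_flatten, pieces, List.flatten_splitBy]
  rw [← key l, ← key l']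
  exact (h.perm.map f).prod_eq

theorem length_eq_of_equipartite {V E : Type*} (i j : V)
    (l l' : List (Arc V (E ⊕ V))) (h : routePartition i j l ~r routePartition i j l') :
    l.length = l'.length := by
  let f : Sym2 (List (Arc V (E ⊕ V))) → ℕ :=
    Sym2.lift ⟨fun a b => (a.length + b.length) / 2, fun a b => by simp only [add_comm]⟩
  have key : ∀ l, ((routePartition i j l).map f).sum = l.length := by
    intro l
    have hf : (f ∘ fun p => s(p, mate i j p)) = List.length := by
      funext p
      simp only [f, Function.comp, Sym2.lift_mk, mate, List.length_reverse, List.length_map]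
      omega
    rw [routePartition, List.map_map, hf, ← List.length_flatten, pieces, List.flatten_splitBy]
  rw [← key l, ← key l']
  exact (h.perm.map f).sum_eq

namespace Route

variable {V E : Type*} {G : Graph V E} {i j a b : V}

/-- The common length of the walks of a route. -/
def length : Route G i j a b → ℕ :=
  Quotient.lift (fun l => l.1.length) fun l l' h => length_eq_of_equipartite i j l.1 l'.1 h

/-- The common weight of the walks of a route. -/
def weight (w : E → ℝ) : Route G i j a b → ℝ :=
  Quotient.lift (fun l => walkProd (jumpWeight w) l.1)
    fun l l' h => walkProd_eq_of_equipartite w i j l.1 l'.1 h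

/-- The multiplicity of a route: the number of repetitions of the elementary repeating part of the
route partition of any of its walks. -/
def multiplicity : Route G i j a b → ℕ :=
  Quotient.lift (fun l => cyclicMultiplicity (Cycle.ofList (routePartition i j l.1)))
    fun l l' h => congrArg cyclicMultiplicity (Cycle.coe_eq_coe.2 h :
      Cycle.ofList (routePartition i j l.1) = Cycle.ofList (routePartition i j l'.1))

end Route

/-! ### The series over figures -/

instance {V E : Type*} [Finite V] [Finite E] : Finite (Arc V E) :=
  Finite.of_injective (fun a : Arc V E => (a.src, a.edge, a.tgt)) (by
    rintro ⟨x, e, y⟩ ⟨x', e', y'⟩ h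
    simpa using h)

theorem finite_circuits {V E : Type*} [Finite V] [Finite E] (G : Graph V E) (x y : V) (k : ℕ) :
    {c : Circuit G | c.Visits x ∧ ¬ c.Visits y ∧ c.length = k}.Finite := by
  refine Set.Finite.of_finite_image (f := Subtype.val)
    (((List.finite_length_eq (Arc V E) k).image Cycle.ofList).subset ?_)
    Subtype.val_injective.injOn
  rintro _ ⟨⟨c, v, l, h0, hl, rfl⟩, ⟨-, -, h⟩, rfl⟩
  exact ⟨l, h, rfl⟩

theorem finite_routes {V E : Type*} [Finite V] [Finite E] (G : Graph V E) (i j a b : V) (k : ℕ) :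
    {r : Route G i j a b | r.length = k}.Finite := by
  have h : {l : {l : List (Arc V (E ⊕ V)) // IsAlternating G i j a b l} |
      l.1.length = k}.Finite :=
    Set.Finite.preimage Subtype.val_injective.injOn (List.finite_length_eq (Arc V (E ⊕ V)) k)
  refine (h.image (Quotient.mk (equipartite G i j a b))).subset ?_
  intro r hr
  induction r using Quotient.inductionOn with
  | h l => exact ⟨l, hr, rfl⟩

/-- The sum of `w(c) / μ(c)` over the circuits `c` with `k` arcs that visit `x` but not `y`. -/
def circuitSum {V E : Type*} [Finite V] [Finite E] (G : Graph V E) (w : E → ℝ) (x y : V) (k : ℕ) :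
    ℝ :=
  ∑ c ∈ (finite_circuits G x y k).toFinset, c.weight w / c.multiplicity

/-- The sum of `w(c) / μ(c)` over the alternating routes `c` with `i, j` jumps from `a` to `b` that
have `k` arcs. -/
def routeSum {V E : Type*} [Finite V] [Finite E] (G : Graph V E) (w : E → ℝ) (i j a b : V) (k : ℕ) :
    ℝ :=
  ∑ c ∈ (finite_routes G i j a b k).toFinset, c.weight w / c.multiplicity

/-- The signed sum of `w(c) / μ(c)` over all figures `c` with `k` arcs: the alternating `j → i → j`
and `i → j → i` routes with jumps have sign `+`; the circuits that visit exactly one of `i` and `j`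
and the alternating `j → i` and `i → j` routes with jumps have sign `-`. -/
def figureSum {V E : Type*} [Finite V] [Finite E] (G : Graph V E) (w : E → ℝ) (i j : V) (k : ℕ) :
    ℝ :=
  (routeSum G w i j j j k + routeSum G w i j i i k)
    - (circuitSum G w i j k + circuitSum G w j i k)
    - (routeSum G w i j j i k + routeSum G w i j i j k)

end WalkDist

end

/-! Let M be the weighted adjacency matrix of tG, let N be the reduced matrix, let P and Q be M with
column i, respectively column j, set to zero, and let K have both columns set to zero. The theorem
compares two expressions for det(1 - P) det(1 - Q) / det(1 - N)^2.

Algebraically, the three determinants are the cofactors ii, jj and ji of 1 - M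
(`det_one_sub_updateCol_zero`, `det_one_sub_reducedMatrix`). The walk weights form the inverse of 1
- M, so the quotient is r_ii r_jj / r_ij^2, the exponential of twice the walk distance
(`half_eq_walkDist`).

Combinatorially, `mul_figureSum` shows that k times the k-th signed figure sum is 2 tr N^k - tr P^k
- tr Q^k. For circuits this is orbit counting: those through i avoiding j contribute tr Q^k - tr
K^k, and symmetrically. For routes, every alternating walk from a fixed vertex is a free word in
letters, namely the pieces starting at j: the jump, with sign +, and the hitting walks j → i, with
sign -. The product of the signs tells whether the walk ends where it began, so closed minus open
routes amount to the sum of F^s / s, where F is the signed generating function of the letters. The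
entries of N are arranged so that F is the first-return series of N at j
(`letterSeries_eq_firstReturnSeries`), and -log(1 - F) then accounts for tr N^k - tr K^k
(`sum_coeff_firstReturnSeries_pow`).

Summation over k turns traces into log-determinants. To cover merely convergent series, the identity
is proved for zN, zP, zQ with z near 0, continued analytically to |z| < 1, and brought to z = 1 by
Abel's limit theorem (`exp_mul_det_sq_of_tendsto`). -/

namespace WalkDist

/-! ### Rotation orbits and multiplicities of cyclic words -/

section Rotations

variable {α : Type*}

theorem length_flatten_replicate (m : ℕ) (s : List α) :
    (List.replicate m s).flatten.length = m * s.length := by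
  simp

theorem flatten_replicate_rotate (m : ℕ) (s : List α) :
    (List.replicate m s).flatten.rotate s.length = (List.replicate m s).flatten := by
  cases m with
  | zero => simp
  | succ m =>
    conv_lhs => rw [List.replicate_succ, List.flatten_cons, List.rotate_append_length_eq]
    rw [List.replicate_succ', List.flatten_append, List.flatten_singleton]

/-- Invariance under rotation by `d` makes consecutive blocks of length `d` equal; after removing
the first block the remainder is again invariant. -/
theorem eq_flatten_replicate_of_rotate_eq {d : ℕ} :
    ∀ (m : ℕ) (l : List α), l.length = m * d → l.rotate d = l →
      l = (List.replicate m (l.take d)).flatten := by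
  intro m
  induction m with
  | zero =>
    intro l hl _
    simpa using hl
  | succ m ih =>
    intro l hl hr
    have hd : d ≤ l.length := by rw [hl]; nlinarith
    have h1 : l.drop d ++ l.take d = l := by
      rw [← List.rotate_eq_drop_append_take hd, hr]
    rcases Nat.eq_zero_or_pos m with rfl | hm
    · simp [List.take_of_length_le (by omega : l.length ≤ d)]
    have hlen : (l.drop d).length = m * d := by
      rw [List.length_drop, hl, Nat.succ_mul]; omega
    have hdd : d ≤ (l.drop d).length := by rw [hlen]; nlinarith
    have htake : (l.drop d).take d = l.take d := by
      conv_rhs => rw [← h1]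
      rw [List.take_append_of_le_length hdd]
    have hrot : (l.drop d).rotate d = l.drop d := by
      rw [List.rotate_eq_drop_append_take hdd, htake]
      conv_rhs => rw [← h1]
      rw [List.drop_append_of_le_length hdd]
    have := ih (l.drop d) hlen hrot
    rw [htake] at this
    rw [List.replicate_succ, List.flatten_cons, ← this, List.take_append_drop]

/-- The rotation orbit has as many elements as the minimal period `d` of `l` under one-step
rotation, and `d` divides the length `n`. The quotient `n / d` is the multiplicity, because any
block whose repetition gives `l` up to rotation has length a multiple of `d`. -/
theorem ncard_isRotated_mul_cyclicMultiplicity (l : List α) (hl : l ≠ []) :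
    {l' : List α | l' ~r l}.ncard * cyclicMultiplicity (l : Cycle α) = l.length := by
  classical
  set n := l.length with hn
  have hnpos : 0 < n := List.length_pos_iff.2 hl
  let f : List α → List α := fun x => x.rotate 1
  have hf : ∀ k, f^[k] l = l.rotate k := by
    intro k
    induction k with
    | zero => simp
    | succ k ih => rw [Function.iterate_succ_apply', ih]; simp [f, List.rotate_rotate]
  have hper : ∀ k, Function.IsPeriodicPt f k l ↔ l.rotate k = l := by
    intro k
    rw [Function.IsPeriodicPt, Function.IsFixedPt, hf]
  set d := Function.minimalPeriod f l with hd
  have hdn : d ∣ n := Function.IsPeriodicPt.minimalPeriod_dvd ((hper n).2 l.rotate_length)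
  have hdpos : 0 < d := Nat.pos_of_dvd_of_pos hdn hnpos
  have hrotd : l.rotate d = l := (hper d).1 (Function.isPeriodicPt_minimalPeriod f l)
  have hset : {l' : List α | l' ~r l} = (fun k => f^[k] l) '' (Set.Iio d) := by
    ext l'
    constructor
    · intro h
      obtain ⟨k, hk⟩ := (h : l' ~r l).symm
      refine ⟨k % d, Nat.mod_lt _ hdpos, ?_⟩
      simp only
      rw [Function.iterate_mod_minimalPeriod_eq, hf, hk]
    · rintro ⟨k, -, rfl⟩
      simp only [hf]
      exact List.IsRotated.forall l k
  have hcard : {l' : List α | l' ~r l}.ncard = d := by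
    rw [hset, Set.InjOn.ncard_image]
    · simp
    · exact Function.iterate_injOn_Iio_minimalPeriod
  obtain ⟨q, hq⟩ := hdn
  have hqpos : 0 < q := by
    rcases Nat.eq_zero_or_pos q with rfl | h
    · simp at hq; omega
    · exact h
  have hmult : cyclicMultiplicity (l : Cycle α) = q := by
    apply IsGreatest.csSup_eq
    constructor
    · refine ⟨l.take d, ?_⟩
      rw [← eq_flatten_replicate_of_rotate_eq q l (by rw [← hn, hq, mul_comm]) hrotd]
    · rintro m ⟨s, hs⟩
      have hs' : (List.replicate m s).flatten ~r l := Cycle.coe_eq_coe.1 hs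
      have hlen : m * s.length = n := by
        rw [← length_flatten_replicate]; exact hs'.perm.length_eq
      obtain ⟨k, hk⟩ := hs'
      have hrs : l.rotate s.length = l := by
        rw [← hk, List.rotate_rotate, add_comm, ← List.rotate_rotate, flatten_replicate_rotate]
      have hds : d ∣ s.length := Function.IsPeriodicPt.minimalPeriod_dvd ((hper _).2 hrs)
      obtain ⟨r, hr⟩ := hds
      have : q = m * r := by
        apply Nat.eq_of_mul_eq_mul_left hdpos
        rw [← hq, ← hlen, hr]; ring
      rw [this]
      apply Nat.le_mul_of_pos_right
      rcases Nat.eq_zero_or_pos r with rfl | h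
      · simp at this; omega
      · exact h
  rw [hcard, hmult, hq]

end Rotations

/-! ### Traces, log-determinants and Abel summation -/

section Analysis

open scoped Matrix.Norms.Operator

/-- Gelfand's formula: the k-th roots of the norms tend to the spectral radius, so the norms are
eventually below a geometric sequence of ratio `r < 1`. -/
theorem summable_norm_pow_of_spectralRadius_lt_one {A : Type*} [NormedRing A] [NormedAlgebra ℂ A]
    [CompleteSpace A] {a : A} (ha : spectralRadius ℂ a < 1) : Summable fun k : ℕ => ‖a ^ k‖ := by
  obtain ⟨r, hr, hr1⟩ := ENNReal.lt_iff_exists_nnreal_btwn.1 ha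
  have hr1' : (r : ℝ) < 1 := by exact_mod_cast hr1
  have hev := (spectrum.pow_nnnorm_pow_one_div_tendsto_nhds_spectralRadius a).eventually
    (gt_mem_nhds hr)
  refine Summable.of_norm_bounded_eventually_nat
    (summable_geometric_of_lt_one r.coe_nonneg hr1') ?_
  filter_upwards [hev, eventually_gt_atTop 0] with k hk hk0
  rw [norm_norm]
  have hk' : ((‖a ^ k‖₊ : ENNReal)) < (r : ENNReal) ^ k := by
    have hk1 : (0 : ℝ) < k := by exact_mod_cast hk0
    have := ENNReal.rpow_lt_rpow hk hk1
    rwa [← ENNReal.rpow_mul, one_div, inv_mul_cancel₀ hk1.ne', ENNReal.rpow_one,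
      ENNReal.rpow_natCast] at this
  have : ‖a ^ k‖₊ < r ^ k := by exact_mod_cast hk'
  exact_mod_cast this.le

variable {ι : Type*} [Fintype ι] [DecidableEq ι]

theorem norm_entry_le {𝕜 : Type*} [RCLike 𝕜] (M : Matrix ι ι 𝕜) (u v : ι) : ‖M u v‖ ≤ ‖M‖ := by
  have h : ‖M u v‖₊ ≤ ‖M‖₊ := by
    rw [Matrix.linfty_opNNNorm_def]
    exact (Finset.single_le_sum (f := fun v => ‖M u v‖₊) (fun _ _ => zero_le) (Finset.mem_univ v)).trans
      (Finset.le_sup (f := fun u => ∑ v, ‖M u v‖₊) (Finset.mem_univ u))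
  exact h

theorem summable_abs_pow_entry_of_specRadius_lt_one (M : Matrix ι ι ℝ) (hM : specRadius M < 1)
    (u v : ι) : Summable fun k : ℕ => |(M ^ k) u v| := by
  have h : spectralRadius ℂ (M.map (fun x : ℝ => (x : ℂ))) < 1 := by
    unfold specRadius at hM
    convert! hM
  refine (summable_norm_pow_of_spectralRadius_lt_one h).of_nonneg_of_le
    (fun _ => abs_nonneg _) fun k => ?_
  have hk : (M.map (fun x : ℝ => (x : ℂ))) ^ k = (M ^ k).map (fun x : ℝ => (x : ℂ)) :=
    (map_pow (Complex.ofRealHom.mapMatrix (m := ι)) M k).symm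
  rw [hk]
  refine le_trans ?_ (norm_entry_le _ u v)
  simp

theorem abs_trace_le (M : Matrix ι ι ℝ) : |M.trace| ≤ Fintype.card ι * ‖M‖ := by
  calc |M.trace| ≤ ∑ u, |M u u| := Finset.abs_sum_le_sum_abs _ _
    _ ≤ ∑ _u : ι, ‖M‖ := Finset.sum_le_sum fun u _ => norm_entry_le M u u
    _ = Fintype.card ι * ‖M‖ := by simp

/-- Jacobi's formula, from the factorization 1 - xN = (1 - zN)(1 - (x - z)RN) and the derivative at
0 of det(1 + X·RN), which is tr(RN). -/
theorem hasDerivAt_det_one_sub_smul (N R : Matrix ι ι ℝ) (z : ℝ)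
    (hR : (1 - z • N) * R = 1) :
    HasDerivAt (fun x : ℝ => (1 - x • N).det) (-((R * N).trace * (1 - z • N).det)) z := by
  let p : Polynomial ℝ := (1 + (Polynomial.X : Polynomial ℝ) • (R * N).map Polynomial.C).det
  have hp : ∀ x, p.eval x = (1 + x • (R * N)).det := by
    intro x
    rw [← Polynomial.coe_evalRingHom, RingHom.map_det]
    congr 1
    ext a b
    rw [RingHom.mapMatrix_apply, Matrix.map_apply, Matrix.add_apply, Matrix.add_apply,
      Matrix.smul_apply, Matrix.smul_apply, Matrix.map_apply, Matrix.one_apply, Matrix.one_apply]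
    split_ifs <;> simp [mul_comm x]
  have hp' : p.derivative.eval 0 = (R * N).trace := Matrix.derivative_det_one_add_X_smul _
  have hfun : (fun x : ℝ => (1 - x • N).det) = fun x => (1 - z • N).det * p.eval (-(x - z)) := by
    funext x
    rw [hp, ← Matrix.det_mul]
    congr 1
    rw [mul_add, mul_one, mul_smul_comm, ← mul_assoc, hR, one_mul]
    module
  rw [hfun]
  have h1 : HasDerivAt (fun x : ℝ => -(x - z)) (-1) z := ((hasDerivAt_id z).sub_const z).neg
  have h2 := (p.hasDerivAt (-(z - z)))
  have h3 := (h2.comp z h1).const_mul (1 - z • N).det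
  refine h3.congr_deriv ?_
  rw [sub_self, neg_zero, hp']
  ring

/-- This is log det(1 - zN) = -∑ tr(N^k) z^k / k near 0. The termwise derivative of the series is
tr(RN) with R the Neumann series, so the product has zero derivative and keeps its value 1 at z = 0.
The term k = 0 vanishes because division by zero gives zero. -/
theorem exp_tsum_trace_mul_det (N : Matrix ι ι ℝ) :
    ∃ ε > 0, ∀ z : ℝ, |z| < ε →
      (Summable fun k : ℕ => (N ^ k).trace / k * z ^ k) ∧
      Real.exp (∑' k : ℕ, (N ^ k).trace / k * z ^ k) * (1 - z • N).det = 1 := by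
  set B : ℝ := ‖N‖ + 1 with hB
  have hB0 : 0 < B := by positivity
  have hNB : ‖N‖ ≤ B := by rw [hB]; linarith
  -- This radius gives B r = 1/2, so the derivatives are dominated by a geometric series of ratio
  -- 1/2.
  set r : ℝ := 1 / (2 * B) with hr
  have hr0 : 0 < r := by positivity
  have hBr : B * r = 1 / 2 := by rw [hr]; field_simp
  -- The first summand covers the power 0, the second all positive powers.
  set K : ℝ := Fintype.card ι * ‖(1 : Matrix ι ι ℝ)‖ + Fintype.card ι with hK
  have hK0 : 0 ≤ K := by positivity
  have htr : ∀ k : ℕ, |(N ^ k).trace| ≤ K * B ^ k := by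
    intro k
    refine (abs_trace_le _).trans ?_
    rcases Nat.eq_zero_or_pos k with rfl | hk
    · simp [hK]
    · have h1 : ‖N ^ k‖ ≤ B ^ k := (norm_pow_le' N hk).trans (pow_le_pow_left₀ (norm_nonneg _) hNB k)
      have h2 : (Fintype.card ι : ℝ) ≤ K := by rw [hK]; linarith [show (0:ℝ) ≤ Fintype.card ι * ‖(1 : Matrix ι ι ℝ)‖ by positivity]
      exact mul_le_mul h2 h1 (norm_nonneg _) hK0
  set g : ℕ → ℝ → ℝ := fun k z => (N ^ k).trace / k * z ^ k with hg
  set g' : ℕ → ℝ → ℝ := fun k z => (N ^ k).trace / k * (k * z ^ (k - 1)) with hg'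
  set u : ℕ → ℝ := fun k => K * B * (1 / 2) ^ (k - 1) with hu
  have hu_sum : Summable u := by
    apply Summable.mul_left
    rw [← summable_nat_add_iff 1]
    simpa using summable_geometric_two
  have hball : ∀ z ∈ Metric.ball (0 : ℝ) r, |z| < r := fun z hz => by simpa using hz
  have hderiv : ∀ k z, z ∈ Metric.ball (0 : ℝ) r → HasDerivAt (g k) (g' k z) z :=
    fun k z _ => (hasDerivAt_pow k z).const_mul _
  have hg'eq : ∀ k z, g' (k + 1) z = (N ^ (k + 1)).trace * z ^ k := by
    intro k z
    simp only [hg', Nat.add_sub_cancel]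
    have : ((k + 1 : ℕ) : ℝ) ≠ 0 := by positivity
    field_simp
  have hg'0 : ∀ z, g' 0 z = 0 := fun z => by simp [hg']
  have hbound : ∀ k z, z ∈ Metric.ball (0 : ℝ) r → ‖g' k z‖ ≤ u k := by
    intro k z hz
    rcases k with _ | k
    · rw [hg'0, norm_zero]; positivity
    · rw [hg'eq, Real.norm_eq_abs, abs_mul, abs_pow, hu]
      simp only [Nat.add_sub_cancel]
      calc |(N ^ (k + 1)).trace| * |z| ^ k ≤ (K * B ^ (k + 1)) * r ^ k :=
            mul_le_mul (htr _) (pow_le_pow_left₀ (abs_nonneg _) (hball z hz).le k) (by positivity)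
              (by positivity)
        _ = K * B * (B * r) ^ k := by rw [mul_pow, pow_succ]; ring
        _ = _ := by rw [hBr]
  have h0 : (0 : ℝ) ∈ Metric.ball (0 : ℝ) r := Metric.mem_ball_self hr0
  have hg0 : ∀ k, g k 0 = 0 := by
    intro k
    rcases k with _ | k <;> simp [hg]
  have hsum0 : Summable fun k => g k 0 := by simp [hg0]
  have hpre : IsPreconnected (Metric.ball (0 : ℝ) r) := (convex_ball _ _).isPreconnected
  have hL : ∀ z ∈ Metric.ball (0 : ℝ) r,
      HasDerivAt (fun z => ∑' k, g k z) (∑' k, g' k z) z := fun z hz =>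
    hasDerivAt_tsum_of_isPreconnected hu_sum Metric.isOpen_ball hpre hderiv hbound h0 hsum0 hz
  have hsum : ∀ z ∈ Metric.ball (0 : ℝ) r, Summable fun k => g k z := fun z hz =>
    summable_of_summable_hasDerivAt_of_isPreconnected hu_sum Metric.isOpen_ball hpre hderiv hbound
      h0 hsum0 hz
  have hD : ∀ z ∈ Metric.ball (0 : ℝ) r,
      HasDerivAt (fun z => (1 - z • N).det) (-((∑' k, g' k z) * (1 - z • N).det)) z := by
    intro z hz
    have hn : ‖z • N‖ < 1 := by
      rw [norm_smul, Real.norm_eq_abs]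
      calc |z| * ‖N‖ ≤ r * B := mul_le_mul (hball z hz).le hNB (norm_nonneg _) hr0.le
        _ < 1 := by rw [mul_comm, hBr]; norm_num
    have hs := summable_geometric_of_norm_lt_one hn
    set R := ∑' k : ℕ, (z • N) ^ k with hRdef
    have hR : (1 - z • N) * R = 1 := mul_neg_geom_series _ hn
    have htrace : HasSum (fun k : ℕ => (((z • N) ^ k) * N).trace) (R * N).trace := by
      have hc : Continuous fun M : Matrix ι ι ℝ => (M * N).trace :=
        (continuous_id.mul continuous_const).matrix_trace
      exact hs.hasSum.map ((Matrix.traceAddMonoidHom ι ℝ).comp (AddMonoidHom.mulRight N)) hc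
    have hval : ∑' k, g' k z = (R * N).trace := by
      have h1 : HasSum (fun k => g' (k + 1) z) (R * N).trace := by
        convert htrace using 2 with k
        rw [hg'eq, smul_pow, smul_mul_assoc, Matrix.trace_smul, pow_succ, smul_eq_mul, mul_comm]
      have h2 := (hasSum_nat_add_iff (f := fun k => g' k z) 1).1 h1
      simpa [hg'0] using h2.tsum_eq
    rw [hval]
    exact hasDerivAt_det_one_sub_smul N R z hR
  refine ⟨r, hr0, fun z hz => ?_⟩
  have hz' : z ∈ Metric.ball (0 : ℝ) r := by simpa using hz
  refine ⟨hsum z hz', ?_⟩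
  have hψ : ∀ x ∈ Metric.ball (0 : ℝ) r,
      HasDerivAt (fun x => Real.exp (∑' k, g k x) * (1 - x • N).det) 0 x := by
    intro x hx
    refine ((hL x hx).exp.mul (hD x hx)).congr_deriv ?_
    ring
  have hconst := Metric.isOpen_ball.is_const_of_deriv_eq_zero hpre
    (fun x hx => (hψ x hx).differentiableAt.differentiableWithinAt)
    (fun x hx => (hψ x hx).deriv) hz' h0
  simpa [hg0] using hconst

theorem analyticOnNhd_tsum_pow {g : ℕ → ℝ} {C : ℝ} (hg : ∀ k, |g k| ≤ C) :
    AnalyticOnNhd ℝ (fun z => ∑' k, g k * z ^ k) (Metric.ball 0 1) := by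
  set p := FormalMultilinearSeries.ofScalars ℝ g with hp
  have hrad : 1 ≤ p.radius := by
    have := p.le_radius_of_bound (r := 1) C fun n => by
      rw [hp, FormalMultilinearSeries.ofScalars_norm]
      simpa using hg n
    simpa using this
  have h := (p.hasFPowerSeriesOnBall (lt_of_lt_of_le one_pos hrad)).analyticOnNhd
  have hfun : p.sum = fun z => ∑' k, g k * z ^ k := by
    funext z
    simp [hp, FormalMultilinearSeries.sum, mul_comm]
  rw [hfun] at h
  refine h.mono fun z hz => ?_
  have h1 : edist z 0 < 1 := by
    rw [edist_dist]
    exact (ENNReal.ofReal_lt_one).2 hz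
  exact lt_of_lt_of_le h1 hrad

theorem analyticOnNhd_det_one_sub_smul (N : Matrix ι ι ℝ) (s : Set ℝ) :
    AnalyticOnNhd ℝ (fun z : ℝ => (1 - z • N).det) s := by
  intro z _
  simp only [Matrix.det_apply, Matrix.sub_apply, Matrix.smul_apply, smul_eq_mul, zsmul_eq_mul,
    Units.smul_def]
  refine Finset.analyticAt_fun_sum _ fun σ _ => ?_
  refine analyticAt_const.mul (Finset.analyticAt_fun_prod _ fun i _ => ?_)
  fun_prop

theorem tendsto_det_one_sub_smul (M : Matrix ι ι ℝ) :
    Tendsto (fun z : ℝ => (1 - z • M).det) (𝓝[<] 1) (𝓝 (1 - M).det) := by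
  have : Continuous fun z : ℝ => (1 - z • M).det := by fun_prop
  have h1 := this.tendsto 1
  rw [one_smul] at h1
  exact h1.mono_left nhdsWithin_le_nhds

/-- No spectral bound is assumed: convergence of ∑ g_k alone makes ∑ g_k z^k analytic on the unit
ball and gives it the limit S as z increases to 1. The determinants are polynomials in z, so the
identity near 0 propagates. -/
theorem exp_mul_det_sq_of_tendsto {κ μ : Type*} [Fintype κ] [DecidableEq κ] [Fintype μ]
    [DecidableEq μ] (N : Matrix ι ι ℝ) (P : Matrix κ κ ℝ) (Q : Matrix μ μ ℝ) {g : ℕ → ℝ}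
    (hg0 : g 0 = 0)
    (hg : ∀ k, k ≠ 0 → k * g k = 2 * (N ^ k).trace - (P ^ k).trace - (Q ^ k).trace) {S : ℝ}
    (hS : Tendsto (fun n => ∑ k ∈ Finset.range n, g k) atTop (𝓝 S)) :
    Real.exp S * (1 - N).det ^ 2 = (1 - P).det * (1 - Q).det := by
  obtain ⟨εN, hεN, hN⟩ := exp_tsum_trace_mul_det N
  obtain ⟨εP, hεP, hP⟩ := exp_tsum_trace_mul_det P
  obtain ⟨εQ, hεQ, hQ⟩ := exp_tsum_trace_mul_det Q
  have hgk : ∀ k, g k = 2 * ((N ^ k).trace / k) - (P ^ k).trace / k - (Q ^ k).trace / k := by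
    intro k
    rcases eq_or_ne k 0 with rfl | hk
    · simp [hg0]
    · have hk' : (k : ℝ) ≠ 0 := by exact_mod_cast hk
      rw [← mul_right_inj' hk', hg k hk]
      field_simp
  -- The terms of a convergent series tend to 0, hence are bounded.
  obtain ⟨C, hC⟩ : ∃ C, ∀ k, |g k| ≤ C := by
    have h0 : Tendsto g atTop (𝓝 0) := by
      have := ((tendsto_add_atTop_iff_nat 1).2 hS).sub hS
      simpa [Finset.sum_range_succ] using this
    obtain ⟨C, hC⟩ := h0.abs.bddAbove_range
    exact ⟨C, fun k => hC ⟨k, rfl⟩⟩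
  set h : ℝ → ℝ := fun z => ∑' k, g k * z ^ k with hh
  set DN : ℝ → ℝ := fun z => (1 - z • N).det with hDN
  set DP : ℝ → ℝ := fun z => (1 - z • P).det with hDP
  set DQ : ℝ → ℝ := fun z => (1 - z • Q).det with hDQ
  have hA1 : AnalyticOnNhd ℝ (fun z => Real.exp (h z) * DN z ^ 2) (Metric.ball 0 1) := by
    intro z hz
    exact ((analyticOnNhd_tsum_pow hC z hz).rexp).mul
      ((analyticOnNhd_det_one_sub_smul N _ z hz).pow 2)
  have hA2 : AnalyticOnNhd ℝ (fun z => DP z * DQ z) (Metric.ball 0 1) := fun z hz =>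
    (analyticOnNhd_det_one_sub_smul P _ z hz).mul (analyticOnNhd_det_one_sub_smul Q _ z hz)
  have hnear : (fun z => Real.exp (h z) * DN z ^ 2) =ᶠ[𝓝 0] fun z => DP z * DQ z := by
    have hε : 0 < min εN (min εP εQ) := lt_min hεN (lt_min hεP hεQ)
    filter_upwards [Metric.ball_mem_nhds (0 : ℝ) hε] with z hz
    have hz' : |z| < min εN (min εP εQ) := by simpa using hz
    obtain ⟨sN, eN⟩ := hN z (hz'.trans_le (min_le_left _ _))
    obtain ⟨sP, eP⟩ := hP z (hz'.trans_le ((min_le_right _ _).trans (min_le_left _ _)))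
    obtain ⟨sQ, eQ⟩ := hQ z (hz'.trans_le ((min_le_right _ _).trans (min_le_right _ _)))
    set a := ∑' k : ℕ, (N ^ k).trace / k * z ^ k
    set b := ∑' k : ℕ, (P ^ k).trace / k * z ^ k
    set c := ∑' k : ℕ, (Q ^ k).trace / k * z ^ k
    have hhz : h z = 2 * a - b - c := by
      have := (((sN.hasSum.mul_left 2).sub sP.hasSum).sub sQ.hasSum).tsum_eq
      rw [← this]
      refine tsum_congr fun k => ?_
      rw [hgk]; ring
    have e1 : Real.exp (2 * a - b - c) = Real.exp a ^ 2 / (Real.exp b * Real.exp c) := by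
      rw [Real.exp_sub, Real.exp_sub, two_mul, Real.exp_add]
      field_simp
    simp only [hhz, e1, hDN, hDP, hDQ]
    have hb := (Real.exp_pos b).ne'
    have hc := (Real.exp_pos c).ne'
    rw [div_mul_eq_mul_div, div_eq_iff (mul_ne_zero hb hc)]
    -- After clearing denominators both sides equal 1: the first multiplier squares `eN`, the other
    -- terms multiply `eP` by `eQ`.
    linear_combination (Real.exp a * (1 - z • N).det + 1) * eN -
      (Real.exp c * (1 - z • Q).det) * eP - eQ
  have heq := hA1.eqOn_of_preconnected_of_eventuallyEq hA2
    (convex_ball (0 : ℝ) 1).isPreconnected (Metric.mem_ball_self one_pos) hnear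
  -- Abel's limit theorem enters here.
  have t1 := ((Real.continuous_exp.tendsto S).comp
    (Real.tendsto_tsum_powerSeries_nhdsWithin_lt hS)).mul ((tendsto_det_one_sub_smul N).pow 2)
  have t2 := (tendsto_det_one_sub_smul P).mul (tendsto_det_one_sub_smul Q)
  refine tendsto_nhds_unique (t1.congr' ?_) t2
  have hmem : Set.Ioo (0 : ℝ) 1 ∈ 𝓝[<] (1 : ℝ) := Ioo_mem_nhdsLT zero_lt_one
  filter_upwards [hmem] with z hz
  exact heq (by rw [Metric.mem_ball, dist_zero_right, Real.norm_eq_abs, abs_of_pos hz.1]; exact hz.2)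

end Analysis

/-! ### First-return series and traces of powers -/

section FirstReturn

variable {ι : Type*} [Fintype ι] [DecidableEq ι]

/-- The resolvent `∑ z ^ k N ^ k` as a matrix of formal power series. -/
noncomputable def resolventSeries (N : Matrix ι ι ℝ) : Matrix ι ι (PowerSeries ℝ) :=
  Matrix.of fun u v => PowerSeries.mk fun k => (N ^ k) u v

/-- The generating function of the first returns to `j`, where `N'` is `N` without the arcs
into `j`. -/
noncomputable def firstReturnSeries (N : Matrix ι ι ℝ) (j : ι) : PowerSeries ℝ :=
  PowerSeries.mk fun m => if m = 0 then 0 else ((N.updateCol j 0) ^ (m - 1) * N) j j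

theorem coeff_resolventSeries_mul_map (N M : Matrix ι ι ℝ) (k : ℕ) (u v : ι) :
    PowerSeries.coeff k ((resolventSeries N * M.map PowerSeries.C) u v) = (N ^ k * M) u v := by
  simp [Matrix.mul_apply, resolventSeries, PowerSeries.coeff_mul_C]

/-- The exponent k splits into two in k + 1 ways. This factor later identifies the square of the
resolvent with a derivative. -/
theorem coeff_resolventSeries_mul_self (N : Matrix ι ι ℝ) (k : ℕ) (u v : ι) :
    PowerSeries.coeff k ((resolventSeries N * resolventSeries N) u v) = (k + 1) * (N ^ k) u v := by
  rw [Matrix.mul_apply, map_sum]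
  simp only [resolventSeries, Matrix.of_apply, PowerSeries.coeff_mul, PowerSeries.coeff_mk]
  rw [Finset.sum_comm]
  have : ∀ p ∈ Finset.HasAntidiagonal.antidiagonal k, ∑ x, (N ^ p.1) u x * (N ^ p.2) x v = (N ^ k) u v := by
    intro p hp
    rw [← Finset.HasAntidiagonal.mem_antidiagonal.1 hp, pow_add, Matrix.mul_apply]
  rw [Finset.sum_congr rfl this]
  simp

theorem resolventSeries_mul (N : Matrix ι ι ℝ) :
    resolventSeries N * (1 - (PowerSeries.X : PowerSeries ℝ) • N.map PowerSeries.C) = 1 := by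
  rw [mul_sub, mul_one, mul_smul_comm]
  ext u v k
  rw [Matrix.sub_apply, Matrix.smul_apply, smul_eq_mul, map_sub]
  rcases k with _ | k
  · rw [PowerSeries.coeff_zero_X_mul]
    by_cases h : u = v <;> simp [resolventSeries, Matrix.one_apply, h]
  · rw [PowerSeries.coeff_succ_X_mul, coeff_resolventSeries_mul_map, ← pow_succ]
    by_cases h : u = v <;> simp [resolventSeries, Matrix.one_apply, h, PowerSeries.coeff_one]

/-- Logarithmic derivative of det(1 - XN) = det(1 - XN')(1 - F), proved with resolvents. The matrix
A - A' lives in column j alone, so each resolvent identity for R - R' collapses to products of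
single entries, and the trace difference becomes the jj entry of R R' A. -/
theorem trace_resolventSeries_sub_mul (N : Matrix ι ι ℝ) (j : ι) :
    ((resolventSeries N).trace - (resolventSeries (N.updateCol j 0)).trace) *
        (1 - firstReturnSeries N j) =
      PowerSeries.X * PowerSeries.derivative ℝ (firstReturnSeries N j) := by
  set N' := N.updateCol j 0 with hN'
  set R := resolventSeries N with hR
  set R' := resolventSeries N' with hR'
  set A : Matrix ι ι (PowerSeries ℝ) := (PowerSeries.X : PowerSeries ℝ) • N.map PowerSeries.C with hA
  set A' : Matrix ι ι (PowerSeries ℝ) := (PowerSeries.X : PowerSeries ℝ) • N'.map PowerSeries.C with hA'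
  have h1 : R * (1 - A) = 1 := resolventSeries_mul N
  have h1' : R' * (1 - A') = 1 := resolventSeries_mul N'
  have h2 : (1 - A) * R = 1 := mul_eq_one_comm.1 h1
  have h2' : (1 - A') * R' = 1 := mul_eq_one_comm.1 h1'
  have hdiff : R - R' = R * (A - A') * R' := by
    calc R - R' = R * ((1 - A') * R') - (R * (1 - A)) * R' := by rw [h1, h2', mul_one, one_mul]
      _ = _ := by noncomm_ring
  have hdiff' : R - R' = R' * (A - A') * R := by
    calc R - R' = (R' * (1 - A')) * R - R' * ((1 - A) * R) := by rw [h1', h2, mul_one, one_mul]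
      _ = _ := by noncomm_ring
  have hcol : ∀ u v, (A - A') u v = if v = j then A u j else 0 := by
    intro u v
    by_cases h : v = j
    · subst h; simp [hA, hA', hN']
    · simp [hA, hA', hN', h]
  have hentry : ∀ (Y Z : Matrix ι ι (PowerSeries ℝ)) u v,
      (Y * (A - A') * Z) u v = (Y * A) u j * Z j v := by
    intro Y Z u v
    have : ∀ x, (Y * (A - A')) u x = if x = j then (Y * A) u j else 0 := by
      intro x
      by_cases h : x = j <;> simp [Matrix.mul_apply, hcol, h]
    rw [Matrix.mul_apply]
    simp [this]
  have hF : firstReturnSeries N j = (R' * A) j j := by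
    ext m
    rw [hA, mul_smul_comm, Matrix.smul_apply, smul_eq_mul]
    rcases m with _ | m
    · simp [firstReturnSeries]
    · rw [PowerSeries.coeff_succ_X_mul, coeff_resolventSeries_mul_map]
      simp [firstReturnSeries, hN']
  have hXd : PowerSeries.X * PowerSeries.derivative ℝ (firstReturnSeries N j) =
      (R' * R' * A) j j := by
    ext m
    rw [hA, mul_smul_comm, Matrix.smul_apply, smul_eq_mul]
    rcases m with _ | m
    · simp
    · rw [PowerSeries.coeff_succ_X_mul, PowerSeries.coeff_succ_X_mul]
      have : PowerSeries.coeff m ((R' * R' * N.map PowerSeries.C) j j) =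
          (m + 1) * (N' ^ m * N) j j := by
        rw [Matrix.mul_apply, map_sum, Matrix.mul_apply, Finset.mul_sum]
        refine Finset.sum_congr rfl fun x _ => ?_
        rw [Matrix.map_apply, PowerSeries.coeff_mul_C, hR', coeff_resolventSeries_mul_self]
        ring
      rw [this]
      rw [PowerSeries.coeff_derivative, firstReturnSeries, PowerSeries.coeff_mk,
        if_neg m.succ_ne_zero, Nat.add_sub_cancel, mul_comm]
  -- Here `q` counts all returns to j. With F the first-return series, `e1` says q = F + qF, that is
  -- (1 + q)(1 - F) = 1, while `e2` and `e3` say that the trace difference is (1 + q) X F'.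
  set q := (R * A) j j with hq
  have e1 : q = (R' * A) j j + q * (R' * A) j j := by
    have : R * A = R' * A + R * (A - A') * (R' * A) := by
      rw [← mul_assoc, ← hdiff]; noncomm_ring
    have h := congrFun (congrFun this j) j
    rw [Matrix.add_apply, hentry] at h
    exact h
  have e2 : (R * (R' * A)) j j = (R' * R' * A) j j + q * (R' * R' * A) j j := by
    have : R * (R' * A) = R' * R' * A + R * (A - A') * (R' * R' * A) := by
      rw [mul_assoc R' R' A, ← mul_assoc _ R' (R' * A), ← hdiff]; noncomm_ring
    have h := congrFun (congrFun this j) j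
    rw [Matrix.add_apply, hentry] at h
    exact h
  have e3 : R.trace - R'.trace = (R * (R' * A)) j j := by
    rw [← Matrix.trace_sub, hdiff', Matrix.trace, Matrix.mul_apply]
    refine Finset.sum_congr rfl fun u _ => ?_
    rw [Matrix.diag_apply, hentry, mul_comm]
  rw [e3, e2, hXd, hF]
  linear_combination (R' * R' * A) j j * e1

/-- Applying X d/dX to -log(1 - F) = ∑ F^s / s gives X F' / (1 - F), the difference of the resolvent
traces. Terms with s > k do not reach degree k because X divides F. -/
theorem sum_coeff_firstReturnSeries_pow (N : Matrix ι ι ℝ) (j : ι) (k : ℕ) :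
    (k : ℝ) * ∑ s ∈ Finset.Icc 1 k, (1 / s : ℝ) * PowerSeries.coeff k (firstReturnSeries N j ^ s) =
      (N ^ k).trace - ((N.updateCol j 0) ^ k).trace := by
  set F := firstReturnSeries N j with hF
  set Φ := (resolventSeries N).trace - (resolventSeries (N.updateCol j 0)).trace with hΦ
  have hΦk : ∀ k, PowerSeries.coeff k Φ = (N ^ k).trace - ((N.updateCol j 0) ^ k).trace := by
    intro k
    simp [hΦ, Matrix.trace, resolventSeries]
  have key : Φ * (1 - F) = PowerSeries.X * PowerSeries.derivative ℝ F :=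
    trace_resolventSeries_sub_mul N j
  have hXF : PowerSeries.X ∣ F := by
    rw [PowerSeries.X_dvd_iff]; simp [hF, firstReturnSeries]
  have hXΦ : PowerSeries.X ∣ Φ := by
    rw [PowerSeries.X_dvd_iff, ← PowerSeries.coeff_zero_eq_constantCoeff_apply, hΦk]; simp
  have hterm : ∀ s : ℕ, (k : ℝ) * ((1 / (s + 1 : ℕ) : ℝ) * PowerSeries.coeff k (F ^ (s + 1))) =
      PowerSeries.coeff k (PowerSeries.X * PowerSeries.derivative ℝ F * F ^ s) := by
    intro s
    have h1 : PowerSeries.coeff k (PowerSeries.X * PowerSeries.derivative ℝ (F ^ (s + 1))) =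
        k * PowerSeries.coeff k (F ^ (s + 1)) := by
      rcases k with _ | k
      · simp
      · rw [PowerSeries.coeff_succ_X_mul, PowerSeries.coeff_derivative]; push_cast; ring
    have h2 : PowerSeries.X * PowerSeries.derivative ℝ (F ^ (s + 1)) =
        PowerSeries.C ((s + 1 : ℕ) : ℝ) * (PowerSeries.X * PowerSeries.derivative ℝ F * F ^ s) := by
      rw [Derivation.leibniz_pow, Nat.add_sub_cancel, smul_eq_mul, nsmul_eq_mul, map_natCast]
      ring
    rw [h2, PowerSeries.coeff_C_mul] at h1
    have hs : ((s + 1 : ℕ) : ℝ) ≠ 0 := by positivity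
    field_simp
    linarith
  have hsum : (k : ℝ) * ∑ s ∈ Finset.Icc 1 k, (1 / s : ℝ) * PowerSeries.coeff k (F ^ s) =
      PowerSeries.coeff k (PowerSeries.X * PowerSeries.derivative ℝ F *
        ∑ s ∈ Finset.range k, F ^ s) := by
    rw [Finset.mul_sum, Finset.mul_sum, map_sum, Finset.range_eq_Ico,
      ← Finset.sum_congr rfl fun s _ => hterm s,
      ← Finset.Ico_add_one_right_eq_Icc, Finset.sum_Ico_add' (fun s : ℕ => (k : ℝ) * ((1 / s : ℝ) * PowerSeries.coeff k (F ^ s))) 0 k 1]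
  rw [hsum, ← key, mul_assoc, mul_neg_geom_sum, mul_sub, mul_one, map_sub, hΦk]
  -- The truncation error of the geometric sum has order at least k + 1, since Φ too is divisible by
  -- X.
  have h0 : PowerSeries.coeff k (Φ * F ^ k) = 0 := by
    have : PowerSeries.X ^ (k + 1) ∣ Φ * F ^ k := by
      rw [pow_succ']
      exact mul_dvd_mul hXΦ (pow_dvd_pow_of_dvd hXF k)
    exact PowerSeries.X_pow_dvd_iff.1 this k (Nat.lt_succ_self k)
  rw [h0, sub_zero]

end FirstReturn

/-! ### Walks as lists of arcs -/

section Walks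

variable {V E : Type*} {G : Graph V E}

theorem IsWalk.left_mem : ∀ {l : List (Arc V E)} {u v : V}, IsWalk G u l v → u ∈ G.vertexSet
  | [], _, _, h => h.1
  | _ :: _, _, _, h => h.1 ▸ G.left_mem_of_isLink h.2.1

theorem isWalk_append {l l' : List (Arc V E)} {u v : V} :
    IsWalk G u (l ++ l') v ↔ ∃ x, IsWalk G u l x ∧ IsWalk G x l' v := by
  induction l generalizing u with
  | nil =>
    constructor
    · exact fun h => ⟨u, ⟨h.left_mem, rfl⟩, h⟩
    · rintro ⟨x, ⟨-, rfl⟩, h⟩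
      exact h
  | cons a l ih =>
    simp only [List.cons_append, IsWalk, ih]
    constructor
    · rintro ⟨h1, h2, x, h3, h4⟩
      exact ⟨x, ⟨h1, h2, h3⟩, h4⟩
    · rintro ⟨x, ⟨h1, h2, h3⟩, h4⟩
      exact ⟨h1, h2, x, h3, h4⟩

theorem isWalk_singleton {a : Arc V E} {u v : V} :
    IsWalk G u [a] v ↔ a.src = u ∧ G.IsLink a.edge a.src a.tgt ∧ a.tgt = v := by
  simp only [IsWalk]
  exact ⟨fun ⟨h1, h2, _, h3⟩ => ⟨h1, h2, h3⟩,
    fun ⟨h1, h2, h3⟩ => ⟨h1, h2, G.left_mem_of_isLink h2.symm, h3⟩⟩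

theorem isWalk_concat {l : List (Arc V E)} {a : Arc V E} {u v : V} :
    IsWalk G u (l ++ [a]) v ↔ IsWalk G u l a.src ∧ G.IsLink a.edge a.src a.tgt ∧ a.tgt = v := by
  rw [isWalk_append]
  simp only [isWalk_singleton]
  constructor
  · rintro ⟨_, h1, rfl, h2, h3⟩
    exact ⟨h1, h2, h3⟩
  · rintro ⟨h1, h2, h3⟩
    exact ⟨_, h1, rfl, h2, h3⟩

theorem IsWalk.isLink {l : List (Arc V E)} {u v : V} (h : IsWalk G u l v) :
    ∀ a ∈ l, G.IsLink a.edge a.src a.tgt := by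
  induction l generalizing u with
  | nil => simp
  | cons b l ih =>
    rintro a (_ | ⟨_, ha⟩)
    · exact h.2.1
    · exact ih h.2.2 a ha

theorem IsWalk.src_eq_or {l : List (Arc V E)} {u v : V} (h : IsWalk G u l v) :
    ∀ a ∈ l, a.src = u ∨ ∃ b ∈ l, b.tgt = a.src := by
  induction l generalizing u with
  | nil => simp
  | cons b l ih =>
    rintro a (_ | ⟨_, ha⟩)
    · exact Or.inl h.1
    · rcases ih h.2.2 a ha with h' | ⟨c, hc, hc'⟩
      · exact Or.inr ⟨b, by simp, h'.symm⟩
      · exact Or.inr ⟨c, by simp [hc], hc'⟩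

theorem IsWalk.exists_tgt_eq {l : List (Arc V E)} {u v : V} (h : IsWalk G u l v) (hl : l ≠ []) :
    ∃ b ∈ l, b.tgt = v := by
  rcases List.eq_nil_or_concat' l with rfl | ⟨l', a, rfl⟩
  · exact absurd rfl hl
  · exact ⟨a, by simp, (isWalk_concat.1 h).2.2⟩

/-- Each source in a closed walk is also a target of some arc. Avoiding a vertex thus becomes a
condition on targets, which amounts to zeroing a column of the adjacency matrix. -/
theorem IsWalk.visits_iff {l : List (Arc V E)} {u : V} (h : IsWalk G u l u) (x : V) :
    Visits l x ↔ ∃ a ∈ l, a.tgt = x := by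
  constructor
  · rintro ⟨a, ha, h1 | h1⟩
    · rcases h.src_eq_or a ha with h2 | ⟨b, hb, hb'⟩
      · obtain ⟨b, hb, hb'⟩ := h.exists_tgt_eq (List.ne_nil_of_mem ha)
        exact ⟨b, hb, by rw [hb', ← h2, h1]⟩
      · exact ⟨b, hb, hb'.trans h1⟩
    · exact ⟨a, ha, h1⟩
  · rintro ⟨a, ha, h1⟩
    exact ⟨a, ha, Or.inr h1⟩

theorem isWalk_closed_of_isRotated {l l' : List (Arc V E)} (h : l ~r l') {u : V}
    (hl : IsWalk G u l u) : ∃ v, IsWalk G v l' v := by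
  obtain ⟨n, rfl⟩ := h
  rw [← List.rotate_mod]
  rcases eq_or_ne l [] with rfl | hne
  · exact ⟨u, by simpa using hl⟩
  have hn : n % l.length ≤ l.length := (Nat.mod_lt _ (List.length_pos_iff.2 hne)).le
  rw [List.rotate_eq_drop_append_take hn]
  rw [← List.take_append_drop (n % l.length) l, isWalk_append] at hl
  obtain ⟨x, h1, h2⟩ := hl
  exact ⟨x, isWalk_append.2 ⟨u, h2, h1⟩⟩

theorem IsWalk.start_unique {l : List (Arc V E)} {u v u' v' : V} (h : IsWalk G u l v)
    (h' : IsWalk G u' l v') (hl : l ≠ []) : u = u' := by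
  cases l with
  | nil => exact absurd rfl hl
  | cons a l => exact h.1.symm.trans h'.1

theorem walkProd_pos {w : E → ℝ} (hw : ∀ e ∈ G.edgeSet, 0 < w e) {l : List (Arc V E)} {u v : V}
    (h : IsWalk G u l v) : 0 < walkProd w l := by
  refine List.prod_pos fun x hx => ?_
  obtain ⟨a, ha, rfl⟩ := List.mem_map.1 hx
  exact hw _ (h.isLink a ha).edge_mem

theorem coe_weight {l : List (Arc V E)} (w : E → ℝ) (c : Circuit G)
    (hc : (l : Cycle (Arc V E)) = c.1) : c.weight w = walkProd w l := by
  simp [Circuit.weight, ← hc, walkProd]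

/-! ### Weighted walk sums, and circuits as differences of traces -/

section Sums

/-- The lists of length `k`. -/
noncomputable def listsOfLength (α : Type*) [Finite α] (k : ℕ) : Finset (List α) :=
  (List.finite_length_eq α k).toFinset

@[simp]
theorem mem_listsOfLength {α : Type*} [Finite α] {k : ℕ} {l : List α} :
    l ∈ listsOfLength α k ↔ l.length = k := by
  simp [listsOfLength]

theorem sum_listsOfLength_succ {α : Type*} [Fintype α] (k : ℕ) (f : List α → ℝ) :
    ∑ l ∈ listsOfLength α (k + 1), f l = ∑ a, ∑ l ∈ listsOfLength α k, f (a :: l) := by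
  classical
  rw [← Finset.sum_product']
  refine (Finset.sum_bij (fun p _ => p.1 :: p.2) ?_ ?_ ?_ ?_).symm
  · intro p hp
    simp at hp ⊢
    exact hp
  · rintro ⟨a, l⟩ _ ⟨b, l'⟩ _ h
    simpa using h
  · intro l hl
    cases l with
    | nil => simp at hl
    | cons a l => exact ⟨(a, l), by simpa using hl, rfl⟩
  · intro p _
    rfl

variable [Fintype E]

open Classical in
/-- The weighted adjacency matrix of the arcs of `G` that satisfy `P`. -/
noncomputable def arcMatrix (G : Graph V E) (w : E → ℝ) (P : Arc V E → Prop) : Matrix V V ℝ :=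
  Matrix.of fun u v => ∑ e : E, if G.IsLink e u v ∧ P ⟨u, e, v⟩ then w e else 0

theorem adjMatrix_eq_arcMatrix (w : E → ℝ) : adjMatrix G w = arcMatrix G w fun _ => True := by
  ext u v
  refine Finset.sum_congr rfl fun e _ => ?_
  by_cases h : G.IsLink e u v
  · rw [if_pos h, if_pos ⟨h, trivial⟩]
  · rw [if_neg h, if_neg fun h' => h h'.1]

variable [Fintype V]

/-- Arcs as triples. -/
def arcEquiv (V E : Type*) : Arc V E ≃ V × V × E where
  toFun a := (a.src, a.tgt, a.edge)
  invFun p := ⟨p.1, p.2.2, p.2.1⟩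
  left_inv _ := rfl
  right_inv _ := rfl

noncomputable instance : Fintype (Arc V E) := Fintype.ofEquiv _ (arcEquiv V E).symm

theorem sum_arc (f : Arc V E → ℝ) : ∑ a, f a = ∑ u, ∑ v, ∑ e, f ⟨u, e, v⟩ := by
  rw [← (arcEquiv V E).symm.sum_comp f, Fintype.sum_prod_type]
  refine Finset.sum_congr rfl fun u _ => ?_
  rw [Fintype.sum_prod_type]
  rfl

-- A circuit with k arcs and multiplicity μ has exactly k / μ distinct representing lists, all of
-- the same weight.
open Classical in
theorem circuitSum_eq (w : E → ℝ) (x y : V) {k : ℕ} (hk : k ≠ 0) :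
    k * circuitSum G w x y k = ∑ l ∈ listsOfLength (Arc V E) k,
      if (∃ v, IsWalk G v l v) ∧ Visits l x ∧ ¬ Visits l y then walkProd w l else 0 := by
  have hdisj : ∀ c ∈ (finite_circuits G x y k).toFinset, ∀ c' ∈ (finite_circuits G x y k).toFinset,
      c ≠ c' → Disjoint ((listsOfLength (Arc V E) k).filter fun l : List (Arc V E) => (l : Cycle (Arc V E)) = c.1)
        ((listsOfLength (Arc V E) k).filter fun l : List (Arc V E) => (l : Cycle (Arc V E)) = c'.1) := by
    intro c _ c' _ hcc
    rw [Finset.disjoint_left]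
    intro l h1 h2
    exact hcc (Subtype.ext ((Finset.mem_filter.1 h1).2.symm.trans (Finset.mem_filter.1 h2).2))
  have hterm : ∀ c ∈ (finite_circuits G x y k).toFinset,
      ∑ l ∈ (listsOfLength (Arc V E) k).filter fun l : List (Arc V E) => (l : Cycle (Arc V E)) = c.1, walkProd w l =
        k * (c.weight w / c.multiplicity) := by
    intro c hc
    obtain ⟨v, l₀, hne, -, hl₀⟩ := c.2
    have hlen : l₀.length = k := by
      have := ((Set.Finite.mem_toFinset _).1 hc).2.2
      rw [Circuit.length, ← hl₀] at this
      exact this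
    have hcard := ncard_isRotated_mul_cyclicMultiplicity l₀ hne
    have hset : {l' : List (Arc V E) | l' ~r l₀} =
        ((listsOfLength (Arc V E) k).filter fun l : List (Arc V E) => (l : Cycle (Arc V E)) = c.1 : Finset _) := by
      ext l
      simp only [Set.mem_ofPred_eq, Finset.coe_filter, mem_listsOfLength, ← hl₀, Cycle.coe_eq_coe]
      exact ⟨fun h => ⟨h.perm.length_eq.trans hlen, h⟩, fun h => h.2⟩
    rw [hset, Set.ncard_coe_finset, hlen] at hcard
    have hμ : c.multiplicity = cyclicMultiplicity (l₀ : Cycle (Arc V E)) := by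
      rw [Circuit.multiplicity, hl₀]
    rw [Finset.sum_congr rfl fun l hl =>
      (coe_weight w c (Finset.mem_filter.1 hl).2).symm, Finset.sum_const, nsmul_eq_mul, hμ]
    have : (cyclicMultiplicity (l₀ : Cycle (Arc V E)) : ℝ) ≠ 0 := by
      intro h
      rw [Nat.cast_eq_zero.1 h, mul_zero] at hcard
      exact hk hcard.symm
    have hcard' := congrArg (Nat.cast (R := ℝ)) hcard
    rw [Nat.cast_mul] at hcard'
    field_simp
    linear_combination c.weight w * hcard'
  rw [circuitSum, Finset.mul_sum, ← Finset.sum_congr rfl hterm, ← Finset.sum_biUnion hdisj,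
    ← Finset.sum_filter]
  refine Finset.sum_congr ?_ fun _ _ => rfl
  ext l
  simp only [Finset.mem_biUnion, Set.Finite.mem_toFinset, Set.mem_ofPred_eq, Finset.mem_filter,
    mem_listsOfLength]
  constructor
  · rintro ⟨c, ⟨h1, h2, h3⟩, h4, h5⟩
    refine ⟨h4, ?_, ?_, ?_⟩
    · obtain ⟨v, l₀, hne, hw, hl₀⟩ := c.2
      exact isWalk_closed_of_isRotated (Cycle.coe_eq_coe.1 (hl₀.trans h5.symm)) hw
    · simpa [Circuit.Visits, ← h5] using! h1
    · simpa [Circuit.Visits, Visits, ← h5] using! h2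
  · rintro ⟨h4, ⟨v, hv⟩, h1, h2⟩
    have hne : l ≠ [] := by rintro rfl; simp at h4; exact hk h4.symm
    refine ⟨⟨(l : Cycle (Arc V E)), v, l, hne, hv, rfl⟩, ⟨?_, ?_, ?_⟩, h4, rfl⟩
    · simpa [Circuit.Visits] using! h1
    · simpa [Circuit.Visits, Visits] using! h2
    · simpa [Circuit.length] using h4

variable [DecidableEq V]

open Classical in
theorem sum_walkProd (hV : G.vertexSet = Set.univ) (w : E → ℝ) (P : Arc V E → Prop) (k : ℕ)
    (u v : V) :
    ∑ l ∈ listsOfLength (Arc V E) k,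
        (if IsWalk G u l v ∧ ∀ a ∈ l, P a then walkProd w l else 0) =
      (arcMatrix G w P ^ k) u v := by
  induction k generalizing u with
  | zero =>
    have : listsOfLength (Arc V E) 0 = {[]} := by ext l; simp
    rw [this, Finset.sum_singleton, pow_zero, Matrix.one_apply]
    simp [IsWalk, walkProd, hV]
  | succ k ih =>
    rw [sum_listsOfLength_succ, sum_arc, pow_succ', Matrix.mul_apply, Finset.sum_eq_single u]
    · refine Finset.sum_congr rfl fun x _ => ?_
      rw [← ih x, arcMatrix, Matrix.of_apply, Finset.sum_mul]
      refine Finset.sum_congr rfl fun e _ => ?_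
      rw [Finset.mul_sum]
      refine Finset.sum_congr rfl fun l _ => ?_
      by_cases h1 : G.IsLink e u x ∧ P ⟨u, e, x⟩
      · by_cases h2 : IsWalk G x l v ∧ ∀ a ∈ l, P a
        · rw [if_pos h1, if_pos h2, if_pos]
          · simp [walkProd]
          · refine ⟨⟨rfl, h1.1, h2.1⟩, ?_⟩
            rintro a (_ | ⟨_, ha⟩)
            · exact h1.2
            · exact h2.2 a ha
        · rw [if_neg h2, mul_zero, if_neg]
          rintro ⟨h3, h4⟩
          exact h2 ⟨h3.2.2, fun a ha => h4 a (by simp [ha])⟩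
      · rw [if_neg h1, zero_mul, if_neg]
        rintro ⟨h3, h4⟩
        exact h1 ⟨h3.2.1, h4 _ (by simp)⟩
    · intro x _ hx
      refine Finset.sum_eq_zero fun y _ => Finset.sum_eq_zero fun e _ =>
        Finset.sum_eq_zero fun l _ => ?_
      rw [if_neg]
      rintro ⟨h3, -⟩
      exact hx h3.1
    · simp

-- A nonempty list of arcs fixes its starting vertex, so the trace counts each closed walk once; the
-- empty walk would be counted at every vertex.
open Classical in
theorem sum_closed_walkProd (hV : G.vertexSet = Set.univ) (w : E → ℝ) (P : Arc V E → Prop) {k : ℕ}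
    (hk : k ≠ 0) :
    ∑ l ∈ listsOfLength (Arc V E) k,
        (if (∃ v, IsWalk G v l v) ∧ ∀ a ∈ l, P a then walkProd w l else 0) =
      (arcMatrix G w P ^ k).trace := by
  simp only [Matrix.trace, Matrix.diag_apply, ← sum_walkProd hV]
  rw [Finset.sum_comm]
  refine Finset.sum_congr rfl fun l hl => ?_
  have hne : l ≠ [] := by rintro rfl; simp at hl; exact hk hl.symm
  by_cases h : ∃ v, IsWalk G v l v
  · obtain ⟨v, hv⟩ := h
    rw [Finset.sum_eq_single v]
    · simp only [hv, true_and]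
      congr 1
      simp only [eq_iff_iff, and_iff_right_iff_imp]
      exact fun _ => ⟨v, hv⟩
    · intro u _ hu
      rw [if_neg]
      exact fun h' => hu (h'.1.start_unique hv hne)
    · simp
  · rw [if_neg (fun h' => h h'.1), Finset.sum_eq_zero]
    intro u _
    rw [if_neg (fun h' => h ⟨u, h'.1⟩)]

/-- Closed walks avoiding y, minus those avoiding both x and y. -/
theorem mul_circuitSum (hV : G.vertexSet = Set.univ) (w : E → ℝ) (x y : V) {k : ℕ} (hk : k ≠ 0) :
    k * circuitSum G w x y k = (arcMatrix G w (fun a => a.tgt ≠ y) ^ k).trace -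
      (arcMatrix G w (fun a => a.tgt ≠ x ∧ a.tgt ≠ y) ^ k).trace := by
  classical
  rw [circuitSum_eq w x y hk, ← sum_closed_walkProd hV w _ hk, ← sum_closed_walkProd hV w _ hk,
    ← Finset.sum_sub_distrib]
  refine Finset.sum_congr rfl fun l _ => ?_
  by_cases h : ∃ v, IsWalk G v l v
  · obtain ⟨v, hv⟩ := h
    have hex : (∃ v, IsWalk G v l v) := ⟨v, hv⟩
    simp only [hex, true_and, hv.visits_iff]
    by_cases hy : ∃ a ∈ l, a.tgt = y
    · rw [if_neg (fun h => h.2 hy), if_neg, if_neg, sub_zero]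
      · obtain ⟨a, ha, ha'⟩ := hy
        exact fun h => (h a ha).2 ha'
      · obtain ⟨a, ha, ha'⟩ := hy
        exact fun h => h a ha ha'
    · have hy' : ∀ a ∈ l, a.tgt ≠ y := fun a ha h => hy ⟨a, ha, h⟩
      by_cases hx : ∃ a ∈ l, a.tgt = x
      · rw [if_pos ⟨hx, hy⟩, if_pos hy', if_neg, sub_zero]
        obtain ⟨a, ha, ha'⟩ := hx
        exact fun h => (h a ha).1 ha'
      · rw [if_neg (fun h => hx h.1), if_pos hy', if_pos, sub_self]
        exact fun a ha => ⟨fun h => hx ⟨a, ha, h⟩, hy' a ha⟩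
  · simp [h]

end Sums

end Walks

/-! ### The walk weights as the inverse of 1 - M -/

section WalkWeights

variable {V E : Type*} [Fintype E] {G : Graph V E}

theorem adjMatrix_smul (w : E → ℝ) (t : ℝ) :
    adjMatrix G (fun e => t * w e) = t • adjMatrix G w := by
  ext u v
  simp [adjMatrix, Finset.mul_sum]

theorem adjMatrix_isSymm (w : E → ℝ) : (adjMatrix G w).transpose = adjMatrix G w := by
  ext u v
  refine Finset.sum_congr rfl fun e _ => ?_
  by_cases h : G.IsLink e u v
  · rw [if_pos h, if_pos h.symm]
  · rw [if_neg h, if_neg fun h' => h h'.symm]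

theorem adjMatrix_nonneg {w : E → ℝ} (hw : ∀ e ∈ G.edgeSet, 0 < w e) (u v : V) :
    0 ≤ adjMatrix G w u v := by
  refine Finset.sum_nonneg fun e _ => ?_
  split_ifs with h
  · exact (hw e h.edge_mem).le
  · exact le_rfl

variable [Fintype V]

open Classical Pointwise in
theorem specRadius_smul_lt_one (M : Matrix V V ℝ) {t : ℝ} (ht : 0 < t)
    (h : ENNReal.ofReal t < (specRadius M)⁻¹) : specRadius (t • M) < 1 := by
  have hmap : (t • M).map (fun x : ℝ => (x : ℂ)) = (t : ℂ) • M.map (fun x : ℝ => (x : ℂ)) := by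
    ext u v; simp
  have hle : specRadius (t • M) ≤ ENNReal.ofReal t * specRadius M := by
    rw [specRadius, hmap]
    refine iSup₂_le fun z hz => ?_
    have hu : IsUnit (t : ℂ) := by simpa using ht.ne'
    have hz' : (hu.unit⁻¹ : ℂˣ) • z ∈ spectrum ℂ (M.map (fun x : ℝ => (x : ℂ))) := by
      have := spectrum.unit_smul_eq_smul (M.map (fun x : ℝ => (x : ℂ))) hu.unit
      have h2 : z ∈ hu.unit • spectrum ℂ (M.map (fun x : ℝ => (x : ℂ))) := by
        rw [← this]; exact hz
      exact Set.mem_smul_set_iff_inv_smul_mem.1 h2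
    have hle := le_iSup₂ (f := fun (k : ℂ) (_ : k ∈ spectrum ℂ (M.map (fun x : ℝ => (x : ℂ)))) =>
      (‖k‖₊ : ENNReal)) _ hz'
    have hz2 : z = (t : ℂ) * ((hu.unit⁻¹ : ℂˣ) • z) := by
      rw [Units.smul_def, smul_eq_mul, ← mul_assoc]
      simp [ht.ne']
    conv_lhs => rw [hz2]
    rw [nnnorm_mul, ENNReal.coe_mul]
    refine mul_le_mul' (le_of_eq ?_) hle
    rw [ENNReal.ofReal, ENNReal.coe_inj]
    ext
    simp [abs_of_pos ht, ht.le]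
  refine hle.trans_lt ?_
  -- In `ENNReal` the inverse of 0 is ⊤, and cancellation against the inverse needs a nonzero
  -- radius.
  rcases eq_or_ne (specRadius M) 0 with h0 | h0
  · rw [h0, mul_zero]; exact one_pos
  · have htop : specRadius M ≠ ⊤ := by
      intro h'
      rw [h'] at h
      simp at h
    calc ENNReal.ofReal t * specRadius M < (specRadius M)⁻¹ * specRadius M :=
          ENNReal.mul_lt_mul_left h0 htop h
      _ = 1 := ENNReal.inv_mul_cancel h0 htop

variable [DecidableEq V]

/-- Walks are grouped by length. Positivity of the weights turns convergence of the sums over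
lengths into unconditional summability over walks, so `walkWeight` is a genuine sum and not the
default value 0. -/
theorem hasSum_walkWeight (hV : G.vertexSet = Set.univ) {w : E → ℝ}
    (hw : ∀ e ∈ G.edgeSet, 0 < w e) (hM : specRadius (adjMatrix G w) < 1) (u v : V) :
    (Summable fun l : {l : List (Arc V E) // IsWalk G u l v} => walkProd w l.1) ∧
      HasSum (fun k : ℕ => (adjMatrix G w ^ k) u v) (walkWeight G w u v) := by
  classical
  set F : List (Arc V E) → ℝ := fun l => if IsWalk G u l v then walkProd w l else 0 with hF
  have hF0 : ∀ l, 0 ≤ F l := by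
    intro l
    simp only [hF]
    split_ifs with h
    · exact (walkProd_pos hw h).le
    · exact le_rfl
  have hFk : ∀ k, ∑ l ∈ listsOfLength (Arc V E) k, F l = (adjMatrix G w ^ k) u v := by
    intro k
    rw [adjMatrix_eq_arcMatrix, ← sum_walkProd hV]
    refine Finset.sum_congr rfl fun l _ => ?_
    simp [hF]
  have hsumk : Summable fun k : ℕ => (adjMatrix G w ^ k) u v :=
    (summable_abs_pow_entry_of_specRadius_lt_one _ hM u v).of_abs
  let e := Equiv.sigmaFiberEquiv (List.length : List (Arc V E) → ℕ)
  have hfib : ∀ k, HasSum (fun l : {l : List (Arc V E) // l.length = k} => F l.1)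
      ((adjMatrix G w ^ k) u v) := by
    intro k
    rw [← hFk k]
    have h1 := (listsOfLength (Arc V E) k).hasSum F
    have h2 : ((listsOfLength (Arc V E) k : Finset (List (Arc V E))) : Set (List (Arc V E))) =
        {l | l.length = k} := by ext l; simp
    have h3 := (hasSum_subtype_iff_indicator (f := F)
      (s := {l : List (Arc V E) | l.length = k}) (a := ∑ l ∈ listsOfLength (Arc V E) k, F l)).2
    refine h3 ?_
    rw [← h2]
    exact hasSum_subtype_iff_indicator.1 h1
  have hsigma : Summable (F ∘ e) := by
    refine (summable_sigma_of_nonneg (f := F ∘ e) fun _ => hF0 _).2 ⟨fun k => (hfib k).summable, ?_⟩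
    refine hsumk.congr fun k => ?_
    exact (hfib k).tsum_eq.symm
  have hsF : Summable F := e.summable_iff.1 hsigma
  have htot : HasSum (fun k : ℕ => (adjMatrix G w ^ k) u v) (∑' l, F l) := by
    have h1 : HasSum (F ∘ e) (∑' l, F l) := e.hasSum_iff.2 hsF.hasSum
    exact h1.sigma hfib
  have hind : F = Set.indicator {l | IsWalk G u l v} (walkProd w) := by
    funext l
    simp [hF, Set.indicator_apply]
  refine ⟨?_, ?_⟩
  · rw [hind] at hsF
    exact summable_subtype_iff_indicator.2 hsF
  · have : walkWeight G w u v = ∑' l, F l := by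
      rw [hind, walkWeight]
      exact tsum_subtype {l | IsWalk G u l v} (walkProd w)
    rw [this]
    exact htot

/-- Connectedness supplies one walk of positive weight; this makes the logarithms in the walk
distance meaningful. -/
theorem walkWeight_pos (hV : G.vertexSet = Set.univ) (hG : IsConnected G) {w : E → ℝ}
    (hw : ∀ e ∈ G.edgeSet, 0 < w e) (hM : specRadius (adjMatrix G w) < 1) (u v : V) :
    0 < walkWeight G w u v := by
  obtain ⟨l, hl⟩ := hG u (by simp [hV]) v (by simp [hV])
  exact (hasSum_walkWeight hV hw hM u v).1.tsum_pos (fun l => (walkProd_pos hw l.2).le) ⟨l, hl⟩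
    (walkProd_pos hw hl)

/-- Splitting off the first arc gives W = 1 + MW, so W inverts 1 - M and Cramer's rule applies. -/
theorem adjugate_eq_det_mul_walkWeight (hV : G.vertexSet = Set.univ) {w : E → ℝ}
    (hw : ∀ e ∈ G.edgeSet, 0 < w e) (hM : specRadius (adjMatrix G w) < 1) (u v : V) :
    (1 - adjMatrix G w).adjugate u v = (1 - adjMatrix G w).det * walkWeight G w u v ∧
      (1 - adjMatrix G w).det ≠ 0 := by
  set M := adjMatrix G w with hMdef
  set W : Matrix V V ℝ := Matrix.of (walkWeight G w) with hW
  have h1 : (1 - M) * W = 1 := by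
    have : W = 1 + M * W := by
      ext u v
      have hs := fun u v => (hasSum_walkWeight hV hw hM u v).2
      have h2 : HasSum (fun k : ℕ => (M ^ (k + 1)) u v) ((M * W) u v) := by
        simp only [pow_succ', Matrix.mul_apply]
        exact hasSum_sum fun x _ => (hs x v).mul_left (M u x)
      have h3 := (hasSum_nat_add_iff (f := fun k : ℕ => (M ^ k) u v) 1).1 h2
      rw [Matrix.add_apply, add_comm]
      refine (hs u v).unique ?_
      simpa using h3
    rw [sub_mul, one_mul]
    nth_rw 1 [this]
    abel
  have hdet : (1 - M).det * W.det = 1 := by rw [← Matrix.det_mul, h1, Matrix.det_one]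
  refine ⟨?_, left_ne_zero_of_mul_eq_one hdet⟩
  have : (1 - M).adjugate = (1 - M).det • W := by
    calc (1 - M).adjugate = (1 - M).adjugate * ((1 - M) * W) := by rw [h1, mul_one]
      _ = (1 - M).det • W := by rw [← mul_assoc, Matrix.adjugate_mul, smul_mul_assoc, one_mul]
  rw [this]
  rfl

end WalkWeights

/-! ### The three determinants as cofactors of 1 - M -/

section Determinants

variable {V : Type*} [Fintype V] [DecidableEq V]

theorem det_one_sub_updateCol_zero (M : Matrix V V ℝ) (i : V) :
    (1 - M.updateCol i 0).det = (1 - M).adjugate i i := by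
  have h : (1 - M).adjugate i i = (1 - M).transpose.adjugate i i := by
    rw [← Matrix.adjugate_transpose, Matrix.transpose_apply]
  rw [h, ← Matrix.det_transpose, Matrix.adjugate_apply]
  congr 1
  ext u v
  by_cases h : u = i
  · subst h
    simp [Matrix.one_apply, Pi.single_apply, eq_comm]
  · simp [h, Matrix.one_apply, eq_comm]

/-- The cofactor is the determinant of 1 - M with row i replaced by e_j. Exchanging columns i and j
and then negating column j costs two signs and turns row i into e_i; the remaining block is 1 minus
the reduced matrix. The correction by 1 at (j, i) cancels the diagonal 1 in the new column j. -/
theorem det_one_sub_reducedMatrix (M : Matrix V V ℝ) {i j : V} (hij : i ≠ j) :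
    (1 - reducedMatrix M i j).det = (1 - M).adjugate j i := by
  rw [Matrix.adjugate_apply]
  set K := (1 - M).updateRow i (Pi.single j 1) with hK
  set d : V → ℝ := fun v => if v = j then -1 else 1 with hd
  set T := K.submatrix id (Equiv.swap i j) * Matrix.diagonal d with hT
  have hTapp : ∀ u v, T u v = K u (Equiv.swap i j v) * d v := by
    intro u v
    rw [hT, Matrix.mul_diagonal, Matrix.submatrix_apply, id]
  have hdetT : T.det = K.det := by
    rw [hT, Matrix.det_mul, Matrix.det_permute', Matrix.det_diagonal, Equiv.Perm.sign_swap hij]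
    simp [hd]
  have hrow : ∀ v, T i v = if v = i then 1 else 0 := by
    intro v
    rw [hTapp]
    rcases eq_or_ne v i with rfl | h1
    · simp [hK, hd, hij]
    · rcases eq_or_ne v j with rfl | h2
      · simp [hK, h1, hij]
      · simp [hK, h1, Equiv.swap_apply_of_ne_of_ne h1 h2, h2]
  rw [← hdetT, Matrix.twoBlockTriangular_det T (fun v => v ≠ i) (by
    intro u hu v hv
    rw [not_not.1 hu, hrow, if_neg hv])]
  have hone : (T.toSquareBlockProp fun v => ¬ v ≠ i).det = 1 := by
    have huniq : ∀ x : {v // ¬ v ≠ i}, x = ⟨i, by simp⟩ := fun x =>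
      Subtype.ext (not_not.1 x.2)
    have : (T.toSquareBlockProp fun v => ¬ v ≠ i) = 1 := by
      ext x y
      rw [huniq x, huniq y]
      simp [Matrix.toSquareBlockProp, hrow]
    rw [this, Matrix.det_one]
  rw [hone, mul_one]
  congr 1
  ext ⟨u, hu⟩ ⟨v, hv⟩
  have happ : (T.toSquareBlockProp fun v => v ≠ i) ⟨u, hu⟩ ⟨v, hv⟩ = T u v := rfl
  rw [happ, hTapp]
  simp only [Matrix.sub_apply, reducedMatrix, Matrix.of_apply, Matrix.one_apply,
    Subtype.mk.injEq]
  rcases eq_or_ne v j with rfl | h2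
  · simp only [hK, hu, hd, Equiv.swap_apply_right, Matrix.updateRow_apply, Matrix.sub_apply,
      Matrix.one_apply, if_true, if_false]
    split_ifs <;> ring
  · simp [hK, hu, hd, h2, Equiv.swap_apply_of_ne_of_ne hv h2, Matrix.one_apply]

end Determinants

/-! ### From the determinant identity to the walk distance -/

section WalkDistance

variable {V E : Type*} [Fintype V] [DecidableEq V] [Fintype E] {G : Graph V E}

/-- In terms of walk weights, the common factor det(1 - M)^2 cancels and leaves e^S r_ji^2 = r_ii
r_jj. Since r_ij = r_ji, taking logarithms finishes. -/
theorem half_eq_walkDist (hV : G.vertexSet = Set.univ) (hG : IsConnected G) {w : E → ℝ} {t : ℝ}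
    (hw : ∀ e ∈ G.edgeSet, 0 < t * w e)
    (hM : specRadius (adjMatrix G fun e => t * w e) < 1) {i j : V} (hij : i ≠ j) {S : ℝ}
    (hS : Real.exp S * (1 - reducedMatrix (adjMatrix G fun e => t * w e) i j).det ^ 2 =
      (1 - (adjMatrix G fun e => t * w e).updateCol i 0).det *
        (1 - (adjMatrix G fun e => t * w e).updateCol j 0).det) :
    1 / 2 * S = walkDist G w t i j := by
  have hadj := adjugate_eq_det_mul_walkWeight (w := fun e => t * w e) hV hw hM
  have hpos := walkWeight_pos (w := fun e => t * w e) hV hG hw hM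
  have hsymm : walkWeight G (fun e => t * w e) i j = walkWeight G (fun e => t * w e) j i := by
    have h : (1 - adjMatrix G fun e => t * w e).adjugate i j =
        (1 - adjMatrix G fun e => t * w e).adjugate j i := by
      have h' := Matrix.adjugate_transpose (1 - adjMatrix G fun e => t * w e)
      rw [Matrix.transpose_sub, Matrix.transpose_one, adjMatrix_isSymm] at h'
      exact congrFun (congrFun h' j) i
    rw [(hadj i j).1, (hadj j i).1] at h
    exact mul_left_cancel₀ (hadj i j).2 h
  rw [det_one_sub_reducedMatrix _ hij, det_one_sub_updateCol_zero, det_one_sub_updateCol_zero,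
    (hadj j i).1, (hadj i i).1, (hadj j j).1] at hS
  set D := (1 - adjMatrix G fun e => t * w e).det
  have hD : D ^ 2 ≠ 0 := pow_ne_zero 2 (hadj i i).2
  have h2 : Real.exp S * walkWeight G (fun e => t * w e) j i ^ 2 =
      walkWeight G (fun e => t * w e) i i * walkWeight G (fun e => t * w e) j j := by
    apply mul_left_cancel₀ hD
    linear_combination hS
  have h3 := congrArg Real.log h2
  rw [Real.log_mul (Real.exp_pos S).ne' (pow_ne_zero 2 (hpos j i).ne'), Real.log_exp, Real.log_pow,
    Real.log_mul (hpos i i).ne' (hpos j j).ne'] at h3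
  simp only [walkDist, hsymm]
  push_cast at h3
  linarith

end WalkDistance

/-! ### Alternating walks as chains of pieces -/

section Pieces

open Classical

variable {V E : Type*} {G : Graph V E} {i j : V}

/-- The jump at `a`. -/
def jump (E : Type*) {V : Type*} (a : V) : Arc V (E ⊕ V) := ⟨a, Sum.inr a, a⟩

/-- A hitting walk without jumps from one of the vertices `i, j` to the other one. -/
def IsHit (G : Graph V E) (i j a : V) (p : List (Arc V (E ⊕ V))) : Prop :=
  IsWalk (addJumps G i j) a p (Equiv.swap i j a) ∧ (∀ x ∈ p, x.edge.isLeft = true) ∧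
    ∀ x ∈ p.dropLast, x.tgt ≠ i ∧ x.tgt ≠ j

/-- A piece of an alternating walk with jumps: a jump or a hitting walk without jumps. -/
def IsPiece (G : Graph V E) (i j a : V) (p : List (Arc V (E ⊕ V))) (c : V) : Prop :=
  (p = [jump E a] ∧ c = a) ∨ (IsHit G i j a p ∧ c = Equiv.swap i j a)

/-- A sequence of consecutive pieces leading from `a` to `b`. -/
def IsPieceChain (G : Graph V E) (i j : V) : V → List (List (Arc V (E ⊕ V))) → V → Prop
  | a, [], b => a = b
  | a, p :: L, b => ∃ c, IsPiece G i j a p c ∧ IsPieceChain G i j c L b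

theorem swap_classical_left (i j : V) : Equiv.swap i j i = j := Equiv.swap_apply_left i j

theorem swap_classical_right (i j : V) : Equiv.swap i j j = i := Equiv.swap_apply_right i j

theorem mem_addJumps {a : V} (ha : a = i ∨ a = j) : a ∈ (addJumps G i j).vertexSet := Or.inr ha

theorem swap_mem {a : V} (ha : a = i ∨ a = j) :
    Equiv.swap i j a = i ∨ Equiv.swap i j a = j := by
  rcases ha with rfl | rfl <;> simp

theorem swap_ne (hij : i ≠ j) {a : V} (ha : a = i ∨ a = j) : Equiv.swap i j a ≠ a := by
  rcases ha with rfl | rfl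
  · simpa using hij.symm
  · simpa using hij

theorem eq_swap_of_ne {a c : V} (ha : a = i ∨ a = j) (hc : c = i ∨ c = j) (h : c ≠ a) :
    c = Equiv.swap i j a := by
  rcases ha with rfl | rfl <;> rcases hc with rfl | rfl <;> simp_all

theorem isLink_of_isRight {x : Arc V (E ⊕ V)} (hx : (addJumps G i j).IsLink x.edge x.src x.tgt)
    (h : x.edge.isRight = true) : (x.tgt = i ∨ x.tgt = j) ∧ x = jump E x.tgt := by
  rcases x with ⟨u, e | v, u'⟩
  · simp at h
  · obtain ⟨h1, h2, h3⟩ := hx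
    change u = v at h2
    change u' = v at h3
    subst h2 h3
    exact ⟨h1, rfl⟩

theorem IsWalk.end_unique {l : List (Arc V E)} {u v u' v' : V} (h : IsWalk G u l v)
    (h' : IsWalk G u' l v') (hl : l ≠ []) : v = v' := by
  rcases List.eq_nil_or_concat' l with rfl | ⟨l', a, rfl⟩
  · exact absurd rfl hl
  · exact (isWalk_concat.1 h).2.2.symm.trans (isWalk_concat.1 h').2.2

theorem IsWalk.exists_tgt_eq_src_of_mem_tail {l : List (Arc V E)} {u v : V} (h : IsWalk G u l v) :
    ∀ y ∈ l.tail, ∃ x ∈ l.dropLast, x.tgt = y.src := by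
  induction l generalizing u with
  | nil => simp
  | cons x l ih =>
    intro y hy
    rw [List.tail_cons] at hy
    cases l with
    | nil => simp at hy
    | cons z l =>
      rw [List.dropLast_cons_cons]
      rcases List.mem_cons.1 hy with rfl | hy'
      · exact ⟨x, by simp, h.2.2.1.symm⟩
      · obtain ⟨x', hx', hx''⟩ := ih h.2.2 y hy'
        exact ⟨x', List.mem_cons_of_mem _ hx', hx''⟩

theorem isWalk_mate {p : List (Arc V (E ⊕ V))} {u v : V} (h : IsWalk (addJumps G i j) u p v)
    (hp : ∀ x ∈ p, x.edge.isLeft = true) : IsWalk (addJumps G i j) v (mate i j p) u := by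
  induction p generalizing u with
  | nil => exact ⟨h.2 ▸ h.1, h.2.symm⟩
  | cons x p ih =>
    have h1 := ih h.2.2 fun y hy => hp y (by simp [hy])
    have hx := hp x (by simp)
    rcases x with ⟨a, e | e, b⟩
    · obtain ⟨h2, h3, h4⟩ := h
      simp only [mate, List.map_cons, List.reverse_cons]
      exact isWalk_concat.2 ⟨h1, h3.symm, h2⟩
    · simp at hx

/-- The restriction is needed: `mateArc` ignores the ends of a jump arc, so it is involutive only on
jumps whose ends agree with their label. -/
theorem mateArc_mateArc {x : Arc V (E ⊕ V)}
    (hx : x.edge.isLeft = true ∨ ∃ a, x = jump E a) : mateArc i j (mateArc i j x) = x := by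
  rcases x with ⟨a, e | e, b⟩
  · rfl
  · rcases hx with hx | ⟨c, hc⟩
    · simp at hx
    · simp only [jump, Arc.mk.injEq, Sum.inr.injEq] at hc
      obtain ⟨rfl, rfl, rfl⟩ := hc
      simp [mateArc]

theorem IsPiece.mate_mate {a c : V} {p : List (Arc V (E ⊕ V))} (h : IsPiece G i j a p c) :
    mate i j (mate i j p) = p := by
  have hx : ∀ x ∈ p, x.edge.isLeft = true ∨ ∃ a, x = jump E a := by
    rcases h with ⟨rfl, -⟩ | ⟨h, -⟩
    · intro x hx
      exact Or.inr ⟨a, List.mem_singleton.1 hx⟩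
    · exact fun x hx => Or.inl (h.2.1 x hx)
  rw [mate, mate, List.map_reverse, List.reverse_reverse, List.map_map]
  conv_rhs => rw [← List.map_id p]
  exact List.map_congr_left fun x h' => mateArc_mateArc (hx x h')

theorem IsPiece.mate {a c : V} {p : List (Arc V (E ⊕ V))} (h : IsPiece G i j a p c) :
    IsPiece G i j (Equiv.swap i j a) (mate i j p) (Equiv.swap i j c) := by
  rcases h with ⟨rfl, rfl⟩ | ⟨h, rfl⟩
  · exact Or.inl ⟨rfl, rfl⟩
  · refine Or.inr ⟨⟨?_, ?_, ?_⟩, rfl⟩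
    · rw [Equiv.swap_apply_self]
      exact isWalk_mate h.1 h.2.1
    · intro x hx
      simp only [WalkDist.mate, List.mem_reverse, List.mem_map] at hx
      obtain ⟨y, hy, rfl⟩ := hx
      have := h.2.1 y hy
      rcases y with ⟨_, _ | _, _⟩
      · rfl
      · simp at this
    · intro x hx
      rw [WalkDist.mate, List.dropLast_reverse, List.mem_reverse, ← List.map_tail,
        List.mem_map] at hx
      obtain ⟨y, hy, rfl⟩ := hx
      have hl := h.2.1 y (List.mem_of_mem_tail hy)
      obtain ⟨x, hx, hxy⟩ := h.1.exists_tgt_eq_src_of_mem_tail y hy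
      have := h.2.2 x hx
      rw [hxy] at this
      rcases y with ⟨_, _ | _, _⟩
      · exact this
      · simp at hl

theorem IsPiece.isWalk {a c : V} {p : List (Arc V (E ⊕ V))} (ha : a = i ∨ a = j)
    (h : IsPiece G i j a p c) : IsWalk (addJumps G i j) a p c := by
  rcases h with ⟨rfl, rfl⟩ | ⟨h, rfl⟩
  · exact isWalk_singleton.2 ⟨rfl, ⟨ha, rfl, rfl⟩, rfl⟩
  · exact h.1

theorem IsPiece.ne_nil (hij : i ≠ j) {a c : V} {p : List (Arc V (E ⊕ V))} (ha : a = i ∨ a = j)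
    (h : IsPiece G i j a p c) : p ≠ [] := by
  rcases h with ⟨rfl, rfl⟩ | ⟨h, rfl⟩
  · simp
  · rintro rfl
    exact swap_ne hij ha h.1.2.symm

theorem IsPiece.end_mem {a c : V} {p : List (Arc V (E ⊕ V))} (ha : a = i ∨ a = j)
    (h : IsPiece G i j a p c) : c = i ∨ c = j := by
  rcases h with ⟨-, rfl⟩ | ⟨-, rfl⟩
  · exact ha
  · exact swap_mem ha

theorem IsPiece.dropLast {a c : V} {p : List (Arc V (E ⊕ V))} (h : IsPiece G i j a p c) :
    ∀ x ∈ p.dropLast, x.tgt ≠ i ∧ x.tgt ≠ j := by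
  rcases h with ⟨rfl, -⟩ | ⟨h, -⟩
  · simp
  · exact h.2.2

theorem IsPiece.tail {a c : V} {p : List (Arc V (E ⊕ V))} (ha : a = i ∨ a = j)
    (h : IsPiece G i j a p c) : ∀ y ∈ p.tail, y.src ≠ i ∧ y.src ≠ j := by
  intro y hy
  obtain ⟨x, hx, hxy⟩ := (h.isWalk ha).exists_tgt_eq_src_of_mem_tail y hy
  rw [← hxy]
  exact h.dropLast x hx

theorem isPieceChain_flatten {a b : V} {L : List (List (Arc V (E ⊕ V)))} (ha : a = i ∨ a = j)
    (h : IsPieceChain G i j a L b) : IsWalk (addJumps G i j) a L.flatten b := by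
  induction L generalizing a with
  | nil => exact ⟨mem_addJumps ha, h⟩
  | cons p L ih =>
    obtain ⟨c, hp, hL⟩ := h
    rw [List.flatten_cons]
    exact isWalk_append.2 ⟨c, hp.isWalk ha, ih (hp.end_mem ha) hL⟩

theorem isChain_of_forall_mem_dropLast {α : Type*} {Q : α → Prop} {l : List α}
    (h : ∀ x ∈ l.dropLast, Q x) : l.IsChain fun x _ => Q x := by
  induction l with
  | nil => simp
  | cons a l ih =>
    cases l with
    | nil => simp
    | cons b l =>
      rw [List.isChain_cons_cons]
      exact ⟨h a (by simp), ih fun x hx => h x (by simp only [List.dropLast_cons_cons]; exact List.mem_cons_of_mem _ hx)⟩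

/-- The cuts fall exactly after the arcs with target i or j: within a piece only the last arc has
such a target. -/
theorem pieces_flatten (hij : i ≠ j) {a b : V} {L : List (List (Arc V (E ⊕ V)))}
    (ha : a = i ∨ a = j) (h : IsPieceChain G i j a L b) : pieces i j L.flatten = L := by
  induction L generalizing a with
  | nil => simp [pieces]
  | cons p L ih =>
    obtain ⟨c, hp, hL⟩ := h
    have h1 := ih (hp.end_mem ha) hL
    rw [pieces] at h1 ⊢
    rw [List.flatten_cons, List.splitBy_append, h1, List.splitBy_of_isChain (hp.ne_nil hij ha)]
    · rfl
    · simpa using isChain_of_forall_mem_dropLast hp.dropLast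
    · intro x hx y _
      obtain ⟨q, rfl⟩ := List.getLast?_eq_some_iff.1 hx
      have := (isWalk_concat.1 (hp.isWalk ha)).2.2
      have hc := hp.end_mem ha
      rw [← this] at hc
      exact decide_eq_false fun h => hc.elim h.1 h.2

theorem isAlternating_iff {a b : V} {l : List (Arc V (E ⊕ V))} :
    IsAlternating G i j a b l ↔ IsWalk (addJumps G i j) a l b ∧ ∀ c, c = i ∨ c = j →
      ∀ s, s <:+: l → IsWalk (addJumps G i j) c s c →
        Visits s (Equiv.swap i j c) ∨ ∀ x ∈ s, x.edge.isRight = true := by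
  constructor
  · rintro ⟨h1, h2, h3⟩
    refine ⟨h1, ?_⟩
    rintro c (rfl | rfl)
    · rw [Equiv.swap_apply_left]; exact h3
    · rw [Equiv.swap_apply_right]; exact h2
  · rintro ⟨h1, h2⟩
    have hi := h2 i (Or.inl rfl)
    have hj := h2 j (Or.inr rfl)
    rw [Equiv.swap_apply_left] at hi
    rw [Equiv.swap_apply_right] at hj
    exact ⟨h1, hj, hi⟩

theorem exists_first_split {α : Type*} {Q : α → Prop} {l : List α} (h : ∃ x ∈ l, Q x) :
    ∃ q x l', l = q ++ x :: l' ∧ Q x ∧ ∀ y ∈ q, ¬ Q y := by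
  induction l with
  | nil => simp at h
  | cons a l ih =>
    by_cases ha : Q a
    · exact ⟨[], a, l, rfl, ha, by simp⟩
    · obtain ⟨q, x, l', rfl, hx, hq⟩ := ih (by simpa [ha] using h)
      exact ⟨a :: q, x, l', rfl, hx, by simpa [ha] using hq⟩

/-- The walk is cut at its first arrival in {i, j}, and the rest is again alternating. The end b
lies in {i, j}, so a nonempty walk always has such an arrival. -/
theorem exists_chain_of_isAlternating (hij : i ≠ j) {b : V} (hb : b = i ∨ b = j) :
    ∀ (n : ℕ) (l : List (Arc V (E ⊕ V))) (a : V), l.length ≤ n → (a = i ∨ a = j) →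
      IsAlternating G i j a b l → ∃ L, IsPieceChain G i j a L b ∧ L.flatten = l := by
  intro n
  induction n with
  | zero =>
    intro l a hn _ h
    obtain rfl : l = [] := List.length_eq_zero_iff.1 (Nat.le_zero.1 hn)
    exact ⟨[], h.1.2, rfl⟩
  | succ n ih =>
    intro l a hn ha h
    rcases eq_or_ne l [] with rfl | hne
    · exact ⟨[], h.1.2, rfl⟩
    obtain ⟨hw, halt⟩ := isAlternating_iff.1 h
    obtain ⟨y, hy, hyb⟩ := hw.exists_tgt_eq hne
    obtain ⟨q, x, l', rfl, hx, hq⟩ := exists_first_split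
      (Q := fun x : Arc V (E ⊕ V) => x.tgt = i ∨ x.tgt = j) ⟨y, hy, hyb ▸ hb⟩
    obtain ⟨u, hwq, rfl, hlink, hwl⟩ := isWalk_append.1 hw
    have hp : IsWalk (addJumps G i j) a (q ++ [x]) x.tgt := isWalk_concat.2 ⟨hwq, hlink, rfl⟩
    have hsplit : q ++ x :: l' = (q ++ [x]) ++ l' := by simp
    have halt' : IsAlternating G i j x.tgt b l' := by
      refine isAlternating_iff.2 ⟨hwl, fun c hc s hs => halt c hc s (hs.trans ?_)⟩
      rw [hsplit]
      exact (List.suffix_append _ _).isInfix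
    obtain ⟨L, hL, rfl⟩ := ih l' x.tgt (by simp at hn; omega) hx halt'
    have hleft : ∀ y ∈ q, y.edge.isLeft = true := by
      intro y hy
      by_contra hy'
      rw [Sum.not_isLeft] at hy'
      exact hq y hy (isLink_of_isRight (hwq.isLink y hy) hy').1
    refine ⟨(q ++ [x]) :: L, ⟨x.tgt, ?_, hL⟩, by simp⟩
    -- A piece returning to its start has not met the other vertex, so alternation leaves only jumps
    -- in it; arcs before the first arrival are not jumps, hence it is one jump.
    by_cases hxa : x.tgt = a
    · left
      refine ⟨?_, hxa⟩
      rcases halt a ha (q ++ [x]) (by rw [hsplit]; exact (List.prefix_append _ _).isInfix)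
        (by rw [hxa] at hp; exact hp) with hv | hv
      · rw [hxa] at hp
        obtain ⟨z, hz, hz'⟩ := (hp.visits_iff _).1 hv
        rcases List.mem_append.1 hz with hz | hz
        · exact absurd (hz' ▸ swap_mem ha) (hq z hz)
        · rw [List.mem_singleton.1 hz, hxa] at hz'
          exact absurd hz'.symm (swap_ne hij ha)
      · have hq0 : q = [] := by
          rcases q with _ | ⟨z, q⟩
          · rfl
          · have h1 := hleft z (by simp)
            have h2 := hv z (by simp)
            rw [← Sum.not_isLeft] at h2
            exact absurd h1 h2
        rw [hq0, List.nil_append, (isLink_of_isRight hlink (hv x (by simp))).2, hxa]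
    · right
      have hxs := eq_swap_of_ne ha hx hxa
      refine ⟨⟨hxs ▸ hp, ?_, ?_⟩, hxs⟩
      · intro y hy
        rcases List.mem_append.1 hy with hy | hy
        · exact hleft y hy
        · rw [List.mem_singleton.1 hy]
          -- A final jump would have its source already in {i, j}, contradicting the choice of first
          -- arrival or `hxa`.
          by_contra hr
          rw [Sum.not_isLeft] at hr
          have hsrc : x.src = x.tgt := congrArg Arc.src (isLink_of_isRight hlink hr).2
          rcases eq_or_ne q [] with rfl | hqne
          · exact hxa (hsrc.symm.trans hwq.2.symm)
          · obtain ⟨z, hz, hz'⟩ := hwq.exists_tgt_eq hqne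
            exact hq z hz (by rw [hz', hsrc]; exact hx)
      · rw [List.dropLast_concat]
        intro y hy
        exact not_or.1 (hq y hy)

/-- Leading jumps are stripped off. If a hitting piece follows, a nonempty remainder ending at a
cannot stop inside it, so it contains the whole piece and visits the other vertex. -/
theorem visits_or_of_prefix {a b : V} {L : List (List (Arc V (E ⊕ V)))} (ha : a = i ∨ a = j)
    (h : IsPieceChain G i j a L b) {s : List (Arc V (E ⊕ V))} (hs : s <+: L.flatten)
    (hw : IsWalk (addJumps G i j) a s a) :
    Visits s (Equiv.swap i j a) ∨ ∀ x ∈ s, x.edge.isRight = true := by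
  induction L generalizing a s with
  | nil =>
    rw [List.flatten_nil, List.prefix_nil] at hs
    simp [hs]
  | cons p L ih =>
    obtain ⟨c, ⟨rfl, rfl⟩ | ⟨hp, rfl⟩, hL⟩ := h
    · rcases s with _ | ⟨x, s⟩
      · simp
      · rw [List.flatten_cons, List.singleton_append, List.cons_prefix_cons] at hs
        obtain ⟨rfl, hs⟩ := hs
        rcases ih ha hL hs hw.2.2 with ⟨y, hy, hy'⟩ | h'
        · exact Or.inl ⟨y, by simp [hy], hy'⟩
        · right
          rintro y (_ | ⟨_, hy⟩)
          · rfl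
          · exact h' y hy
    · rcases eq_or_ne p [] with rfl | hpne
      · have h1 : a = Equiv.swap i j a := hp.1.2
        rw [List.flatten_cons, List.nil_append] at hs
        exact ih ha (by rw [← h1] at hL; exact hL) hs hw
      obtain ⟨z, hz, hz'⟩ := hp.1.exists_tgt_eq hpne
      rw [List.flatten_cons] at hs
      rcases List.prefix_or_prefix_of_prefix hs (List.prefix_append p L.flatten) with h' | h'
      · rcases List.eq_nil_or_concat' p with rfl | ⟨q, x, rfl⟩
        · exact absurd rfl hpne
        rcases List.prefix_concat_iff.1 h' with rfl | h''
        · exact Or.inl ⟨z, hz, Or.inr hz'⟩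
        · rcases eq_or_ne s [] with rfl | hsne
          · simp
          · obtain ⟨y, hy, hy'⟩ := hw.exists_tgt_eq hsne
            have := hp.2.2 y (by rw [List.dropLast_concat]; exact h''.subset hy)
            rw [hy'] at this
            exact absurd ha (not_or.2 this)
      · exact Or.inl ⟨z, h'.subset hz, Or.inr hz'⟩

/-- A nonempty subwalk starting in {i, j} starts at a piece boundary, since later sources within a
piece avoid both vertices. This reduces to prefixes. -/
theorem visits_or_of_infix {a b c : V} {L : List (List (Arc V (E ⊕ V)))} (ha : a = i ∨ a = j)
    (h : IsPieceChain G i j a L b) {x s y : List (Arc V (E ⊕ V))} (hs : x ++ s ++ y = L.flatten)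
    (hc : c = i ∨ c = j) (hw : IsWalk (addJumps G i j) c s c) :
    Visits s (Equiv.swap i j c) ∨ ∀ x ∈ s, x.edge.isRight = true := by
  rcases s with _ | ⟨e, s⟩
  · simp
  induction L generalizing a x with
  | nil => simp at hs
  | cons p L ih =>
    have h0 := h
    obtain ⟨d, hp, hL⟩ := h
    rcases eq_or_ne x [] with rfl | hx
    · rw [List.nil_append] at hs
      have hac : a = c := by
        have hfl := isPieceChain_flatten ha h0
        rw [← hs] at hfl
        exact hfl.1.symm.trans hw.1
      subst hac
      exact visits_or_of_prefix ha h0 ⟨y, hs⟩ hw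
    · rw [List.flatten_cons, List.append_assoc] at hs
      rcases List.append_eq_append_iff.1 hs with ⟨z, hz, hz'⟩ | ⟨z, hz, hz'⟩
      · rcases z with _ | ⟨e', z⟩
        · exact ih (x := []) (hp.end_mem ha) hL (by simpa using hz')
        · exfalso
          rw [List.cons_append, List.cons_append, List.cons.injEq] at hz'
          obtain ⟨rfl, -⟩ := hz'
          have := hp.tail ha e (by
            rw [hz]
            cases x with
            | nil => exact absurd rfl hx
            | cons x0 x => simp)
          rw [hw.1] at this
          exact absurd hc (not_or.2 this)
      · exact ih (x := z) (hp.end_mem ha) hL (by rw [List.append_assoc]; exact hz'.symm)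

theorem isAlternating_iff_exists_chain (hij : i ≠ j) {a b : V} (ha : a = i ∨ a = j)
    (hb : b = i ∨ b = j) {l : List (Arc V (E ⊕ V))} :
    IsAlternating G i j a b l ↔ ∃ L, IsPieceChain G i j a L b ∧ L.flatten = l := by
  constructor
  · exact exists_chain_of_isAlternating hij hb l.length l a le_rfl ha
  · rintro ⟨L, hL, rfl⟩
    refine isAlternating_iff.2 ⟨isPieceChain_flatten ha hL, ?_⟩
    rintro c hc s ⟨x, y, hs⟩ hw
    exact visits_or_of_infix ha hL hs hc hw

end Pieces

/-! ### Encoding alternating walks by free words; route classes as rotation orbits -/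

section Words

open Classical

variable {V E : Type*} {G : Graph V E} {i j : V}

/-- The letters: the pieces that start at `j`. -/
def IsLetter (G : Graph V E) (i j : V) (p : List (Arc V (E ⊕ V))) : Prop :=
  ∃ c, IsPiece G i j j p c

/-- The end of the piece encoded by the letter `p` when it is read from the vertex `a`. -/
noncomputable def stepEnd (i j a : V) (p : List (Arc V (E ⊕ V))) : V :=
  if p = [jump E j] then a else Equiv.swap i j a

/-- The piece encoded by the letter `p` when it is read from the vertex `a`. -/
noncomputable def orient (i j a : V) (p : List (Arc V (E ⊕ V))) : List (Arc V (E ⊕ V)) :=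
  if a = j then p else mate i j p

/-- The sequence of pieces encoded by a word that is read from the vertex `a`. -/
noncomputable def toChain (i j : V) : V → List (List (Arc V (E ⊕ V))) → List (List (Arc V (E ⊕ V)))
  | _, [] => []
  | a, p :: ps => orient i j a p :: toChain i j (stepEnd i j a p) ps

/-- The end of the walk encoded by a word that is read from the vertex `a`. -/
noncomputable def endVertex (i j : V) : V → List (List (Arc V (E ⊕ V))) → V
  | a, [] => a
  | a, p :: ps => endVertex i j (stepEnd i j a p) ps

/-- The sign of a letter. -/
noncomputable def letterSign (j : V) (p : List (Arc V (E ⊕ V))) : ℝ :=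
  if p = [jump E j] then 1 else -1

theorem IsLetter.isPiece {p : List (Arc V (E ⊕ V))} (h : IsLetter G i j p) : IsPiece G i j j p (stepEnd i j j p) := by
  obtain ⟨c, ⟨rfl, rfl⟩ | ⟨hp, rfl⟩⟩ := h
  · exact Or.inl ⟨rfl, by simp [stepEnd]⟩
  · have hne : p ≠ [jump E j] := by
      rintro rfl
      have := hp.2.1 (jump E j) (by simp)
      simp [jump] at this
    exact Or.inr ⟨hp, by simp [stepEnd, hne]⟩

theorem swap_stepEnd (a : V) (p : List (Arc V (E ⊕ V))) :
    Equiv.swap i j (stepEnd i j a p) = stepEnd i j (Equiv.swap i j a) p := by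
  simp only [stepEnd]
  split_ifs <;> rfl

theorem IsLetter.isPiece_orient (hij : i ≠ j) {p : List (Arc V (E ⊕ V))} (h : IsLetter G i j p)
    {a : V} (ha : a = i ∨ a = j) : IsPiece G i j a (orient i j a p) (stepEnd i j a p) := by
  rcases ha with rfl | rfl
  · have := h.isPiece.mate
    rw [swap_stepEnd, Equiv.swap_apply_right] at this
    rwa [orient, if_neg hij]
  · rw [orient, if_pos rfl]
    exact h.isPiece

theorem IsPiece.exists_letter (hij : i ≠ j) {a c : V} {p : List (Arc V (E ⊕ V))}
    (ha : a = i ∨ a = j) (h : IsPiece G i j a p c) :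
    ∃ q, IsLetter G i j q ∧ orient i j a q = p ∧ stepEnd i j a q = c := by
  obtain ⟨q, hq, rfl⟩ : ∃ q, IsLetter G i j q ∧ orient i j a q = p := by
    rcases ha with rfl | rfl
    · refine ⟨WalkDist.mate a j p, ⟨Equiv.swap a j c, ?_⟩, ?_⟩
      · simpa using h.mate
      · rw [orient, if_neg hij, h.mate_mate]
    · exact ⟨p, ⟨c, h⟩, by simp [orient]⟩
  exact ⟨q, hq, rfl, ((hq.isPiece_orient hij ha).isWalk ha).end_unique (h.isWalk ha)
    (h.ne_nil hij ha)⟩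

theorem stepEnd_mem {a : V} (ha : a = i ∨ a = j) (p : List (Arc V (E ⊕ V))) :
    stepEnd i j a p = i ∨ stepEnd i j a p = j := by
  rw [stepEnd]
  split_ifs
  · exact ha
  · exact swap_mem ha

theorem isPieceChain_toChain (hij : i ≠ j) {ps : List (List (Arc V (E ⊕ V)))}
    (h : ∀ p ∈ ps, IsLetter G i j p) {a : V} (ha : a = i ∨ a = j) :
    IsPieceChain G i j a (toChain i j a ps) (endVertex i j a ps) := by
  induction ps generalizing a with
  | nil => rfl
  | cons p ps ih =>
    exact ⟨_, (h p (by simp)).isPiece_orient hij ha,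
      ih (fun q hq => h q (by simp [hq])) (stepEnd_mem ha p)⟩

theorem exists_toChain (hij : i ≠ j) {L : List (List (Arc V (E ⊕ V)))} {a b : V}
    (ha : a = i ∨ a = j) (h : IsPieceChain G i j a L b) :
    ∃ ps, (∀ p ∈ ps, IsLetter G i j p) ∧ toChain i j a ps = L ∧ endVertex i j a ps = b := by
  induction L generalizing a with
  | nil => exact ⟨[], by simp, rfl, h⟩
  | cons p L ih =>
    obtain ⟨c, hp, hL⟩ := h
    obtain ⟨q, hq, h1, rfl⟩ := hp.exists_letter hij ha
    obtain ⟨ps, hps, h2, h3⟩ := ih (hp.end_mem ha) hL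
    refine ⟨q :: ps, ?_, ?_, h3⟩
    · rintro r (_ | ⟨_, hr⟩)
      · exact hq
      · exact hps r hr
    · rw [toChain, h1, h2]

/-- Every letter can be read from either vertex, directly from j and through its mate from i, so any
word is admissible and only the endpoint is a constraint. -/
theorem isAlternating_iff_exists_word (hij : i ≠ j) {a b : V} (ha : a = i ∨ a = j)
    (hb : b = i ∨ b = j) {l : List (Arc V (E ⊕ V))} :
    IsAlternating G i j a b l ↔ ∃ ps, (∀ p ∈ ps, IsLetter G i j p) ∧ endVertex i j a ps = b ∧
      (toChain i j a ps).flatten = l := by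
  rw [isAlternating_iff_exists_chain hij ha hb]
  constructor
  · rintro ⟨L, hL, rfl⟩
    obtain ⟨ps, h1, rfl, h2⟩ := exists_toChain hij ha hL
    exact ⟨ps, h1, h2, rfl⟩
  · rintro ⟨ps, h1, rfl, rfl⟩
    exact ⟨_, isPieceChain_toChain hij h1 ha, rfl⟩

/-- The unordered pair of a piece and its mate. -/
noncomputable def pairOf (i j : V) (p : List (Arc V (E ⊕ V))) : Sym2 (List (Arc V (E ⊕ V))) :=
  s(p, mate i j p)

theorem pairOf_orient {p : List (Arc V (E ⊕ V))} (h : IsLetter G i j p) (a : V) :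
    pairOf i j (orient i j a p) = pairOf i j p := by
  rw [orient]
  split_ifs
  · rfl
  · rw [pairOf, pairOf, h.isPiece.mate_mate, Sym2.eq_swap]

/-- A letter starts at j and a mate at i, so the pair determines which of its members is the letter.
-/
theorem pairOf_injOn (hij : i ≠ j) :
    Set.InjOn (pairOf i j) {p : List (Arc V (E ⊕ V)) | IsLetter G i j p} := by
  intro p hp q hq h
  rcases Sym2.eq_iff.1 h with h | ⟨h, -⟩
  · exact h.1
  · exfalso
    have h1 := (IsLetter.isPiece hp).isWalk (Or.inr rfl)
    have h2 := (IsLetter.isPiece hq).mate.isWalk (swap_mem (Or.inr rfl))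
    rw [← h, Equiv.swap_apply_right] at h2
    exact hij (h2.start_unique h1 ((IsLetter.isPiece hp).ne_nil hij (Or.inr rfl)))

theorem map_pairOf_toChain {ps : List (List (Arc V (E ⊕ V)))}
    (h : ∀ p ∈ ps, IsLetter G i j p) (a : V) :
    (toChain i j a ps).map (pairOf i j) = ps.map (pairOf i j) := by
  induction ps generalizing a with
  | nil => rfl
  | cons p ps ih =>
    rw [toChain, List.map_cons, List.map_cons, pairOf_orient (h p (by simp)),
      ih fun q hq => h q (by simp [hq])]

theorem routePartition_toChain (hij : i ≠ j) {ps : List (List (Arc V (E ⊕ V)))}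
    (h : ∀ p ∈ ps, IsLetter G i j p) {a : V} (ha : a = i ∨ a = j) :
    routePartition i j (toChain i j a ps).flatten = ps.map (pairOf i j) := by
  rw [routePartition, pieces_flatten hij ha (isPieceChain_toChain hij h ha)]
  exact map_pairOf_toChain h a

theorem map_injOn_of_injOn {α β : Type*} {f : α → β} {s : Set α} (hf : Set.InjOn f s) :
    ∀ {l l' : List α}, (∀ x ∈ l, x ∈ s) → (∀ x ∈ l', x ∈ s) → l.map f = l'.map f → l = l'
  | [], [], _, _, _ => rfl
  | [], _ :: _, _, _, h => by simp at h
  | _ :: _, [], _, _, h => by simp at h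
  | a :: l, b :: l', h1, h2, h => by
    rw [List.map_cons, List.map_cons, List.cons.injEq] at h
    rw [hf (h1 a (by simp)) (h2 b (by simp)) h.1,
      map_injOn_of_injOn hf (fun x hx => h1 x (by simp [hx])) (fun x hx => h2 x (by simp [hx])) h.2]

theorem walkProd_toChain (w : E → ℝ) (a : V) (ps : List (List (Arc V (E ⊕ V)))) :
    walkProd (jumpWeight w) (toChain i j a ps).flatten =
      (ps.map (walkProd (jumpWeight w))).prod := by
  rw [walkProd_flatten]
  induction ps generalizing a with
  | nil => rfl
  | cons p ps ih =>
    rw [toChain, List.map_cons, List.prod_cons, ih, List.map_cons, List.prod_cons, orient]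
    split_ifs
    · rfl
    · rw [walkProd_mate]

theorem length_flatten_toChain (a : V) (ps : List (List (Arc V (E ⊕ V)))) :
    (toChain i j a ps).flatten.length = ps.flatten.length := by
  induction ps generalizing a with
  | nil => rfl
  | cons p ps ih =>
    rw [toChain, List.flatten_cons, List.length_append, ih, List.flatten_cons, List.length_append,
      orient]
    split_ifs
    · rfl
    · simp [mate]

/-- Every letter other than the jump toggles between i and j, so the sign records the parity of the
toggles. -/
theorem endVertex_eq (a : V) (ps : List (List (Arc V (E ⊕ V)))) :
    ((ps.map (letterSign j)).prod = 1 ∧ endVertex i j a ps = a) ∨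
      ((ps.map (letterSign j)).prod = -1 ∧ endVertex i j a ps = Equiv.swap i j a) := by
  induction ps generalizing a with
  | nil => simp [endVertex]
  | cons p ps ih =>
    rw [List.map_cons, List.prod_cons, endVertex]
    by_cases hp : p = [jump E j]
    · rw [stepEnd, if_pos hp, letterSign, if_pos hp, one_mul]
      exact ih a
    · rw [stepEnd, if_neg hp, letterSign, if_neg hp]
      rcases ih (Equiv.swap i j a) with ⟨h1, h2⟩ | ⟨h1, h2⟩
      · exact Or.inr ⟨by rw [h1]; norm_num, h2⟩
      · exact Or.inl ⟨by rw [h1]; norm_num, by rw [h2, Equiv.swap_apply_self]⟩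

theorem endVertex_eq_of_perm (a : V) {ps ps' : List (List (Arc V (E ⊕ V)))} (h : ps.Perm ps') :
    endVertex i j a ps = endVertex i j a ps' := by
  have hprod : (ps.map (letterSign j)).prod = (ps'.map (letterSign j)).prod :=
    (h.map _).prod_eq
  rcases endVertex_eq (i := i) (j := j) a ps with ⟨h1, h2⟩ | ⟨h1, h2⟩ <;>
    rcases endVertex_eq (i := i) (j := j) a ps' with ⟨h3, h4⟩ | ⟨h3, h4⟩
  · rw [h2, h4]
  · rw [hprod, h3] at h1; norm_num at h1
  · rw [hprod, h3] at h1; norm_num at h1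
  · rw [h2, h4]

theorem isAlternating_eq_of_routePartition_eq (hij : i ≠ j) {a b : V} (ha : a = i ∨ a = j)
    (hb : b = i ∨ b = j) {l l' : List (Arc V (E ⊕ V))} (hl : IsAlternating G i j a b l)
    (hl' : IsAlternating G i j a b l') (h : routePartition i j l = routePartition i j l') :
    l = l' := by
  obtain ⟨ps, h1, -, rfl⟩ := (isAlternating_iff_exists_word hij ha hb).1 hl
  obtain ⟨ps', h1', -, rfl⟩ := (isAlternating_iff_exists_word hij ha hb).1 hl'
  rw [routePartition_toChain hij h1 ha, routePartition_toChain hij h1' ha] at h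
  rw [map_injOn_of_injOn (pairOf_injOn (G := G) hij) h1 h1' h]

/-- The rotated word is read from the same vertex a; its end depends only on the multiset of letters
and is still b. -/
theorem exists_isAlternating_of_isRotated (hij : i ≠ j) {a b : V} (ha : a = i ∨ a = j)
    (hb : b = i ∨ b = j) {l : List (Arc V (E ⊕ V))} (hl : IsAlternating G i j a b l)
    {L : List (Sym2 (List (Arc V (E ⊕ V))))} (h : L ~r routePartition i j l) :
    ∃ l', IsAlternating G i j a b l' ∧ routePartition i j l' = L := by
  obtain ⟨ps, h1, h2, rfl⟩ := (isAlternating_iff_exists_word hij ha hb).1 hl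
  rw [routePartition_toChain hij h1 ha] at h
  obtain ⟨n, rfl⟩ := h.symm
  have h3 : ∀ p ∈ ps.rotate n, IsLetter G i j p := fun p hp => h1 p (List.mem_rotate.1 hp)
  refine ⟨(toChain i j a (ps.rotate n)).flatten, ?_, ?_⟩
  · refine (isAlternating_iff_exists_word hij ha hb).2 ⟨ps.rotate n, h3, ?_, rfl⟩
    rw [← h2]
    exact endVertex_eq_of_perm a (List.rotate_perm _ _)
  · rw [routePartition_toChain hij h3 ha, List.map_rotate]

theorem routePartition_eq_nil_iff {l : List (Arc V (E ⊕ V))} :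
    routePartition i j l = [] ↔ l = [] := by
  rw [routePartition, List.map_eq_nil_iff, pieces, List.splitBy_eq_nil]

variable [Fintype V] [Fintype E]

/-- A route corresponds to the full rotation orbit of a partition with s entries, so it has s / μ
walks, and each takes the share w / s of w / μ. -/
theorem routeSum_eq (hij : i ≠ j) (w : E → ℝ) {a b : V} (ha : a = i ∨ a = j)
    (hb : b = i ∨ b = j) {k : ℕ} (hk : k ≠ 0) :
    routeSum G w i j a b k = ∑ l ∈ (listsOfLength (Arc V (E ⊕ V)) k).filter
      (IsAlternating G i j a b), walkProd (jumpWeight w) l / (routePartition i j l).length := by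
  let fib : Route G i j a b → Finset (List (Arc V (E ⊕ V))) := fun r =>
    (listsOfLength (Arc V (E ⊕ V)) k).filter fun l =>
      ∃ h : IsAlternating G i j a b l, Quotient.mk (equipartite G i j a b) ⟨l, h⟩ = r
  have hdisj : ∀ r ∈ (finite_routes G i j a b k).toFinset,
      ∀ r' ∈ (finite_routes G i j a b k).toFinset, r ≠ r' → Disjoint (fib r) (fib r') := by
    intro r _ r' _ hrr
    rw [Finset.disjoint_left]
    intro l h1 h2
    obtain ⟨-, h, rfl⟩ := Finset.mem_filter.1 h1
    obtain ⟨-, h', rfl⟩ := Finset.mem_filter.1 h2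
    exact hrr rfl
  have hterm : ∀ r ∈ (finite_routes G i j a b k).toFinset,
      ∑ l ∈ fib r, walkProd (jumpWeight w) l / (routePartition i j l).length =
        r.weight w / r.multiplicity := by
    intro r hr
    have hrk : r.length = k := (Set.Finite.mem_toFinset (finite_routes G i j a b k)).1 hr
    clear hr
    induction r using Quotient.inductionOn with
    | h l₀ =>
    obtain ⟨l₀, h₀⟩ := l₀
    have hlen : l₀.length = k := hrk
    have hne : routePartition i j l₀ ≠ [] := by
      rw [Ne, routePartition_eq_nil_iff]
      rintro rfl
      exact hk hlen.symm
    have hmem : ∀ l, l ∈ fib (Quotient.mk (equipartite G i j a b) ⟨l₀, h₀⟩) ↔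
        IsAlternating G i j a b l ∧ routePartition i j l ~r routePartition i j l₀ := by
      intro l
      simp only [fib, Finset.mem_filter, mem_listsOfLength]
      constructor
      · rintro ⟨-, h, h'⟩
        exact ⟨h, Quotient.exact h'⟩
      · rintro ⟨h, h'⟩
        exact ⟨(length_eq_of_equipartite i j l l₀ h').trans hlen, h, Quotient.sound h'⟩
    have hcard := ncard_isRotated_mul_cyclicMultiplicity _ hne
    have himage : {L | L ~r routePartition i j l₀} = routePartition i j ''
        (fib (Quotient.mk (equipartite G i j a b) ⟨l₀, h₀⟩) : Set (List (Arc V (E ⊕ V)))) := by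
      ext L
      constructor
      · intro hL
        obtain ⟨l', h1, rfl⟩ := exists_isAlternating_of_isRotated hij ha hb h₀ hL
        exact ⟨l', (hmem l').2 ⟨h1, hL⟩, rfl⟩
      · rintro ⟨l, hl, rfl⟩
        exact ((hmem l).1 hl).2
    rw [himage, Set.InjOn.ncard_image, Set.ncard_coe_finset] at hcard
    · have hconst : ∀ l ∈ fib (Quotient.mk (equipartite G i j a b) ⟨l₀, h₀⟩),
          walkProd (jumpWeight w) l / (routePartition i j l).length =
            walkProd (jumpWeight w) l₀ / (routePartition i j l₀).length := by
        intro l hl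
        have h' := ((hmem l).1 hl).2
        rw [walkProd_eq_of_equipartite w i j l l₀ h', h'.perm.length_eq]
      rw [Finset.sum_congr rfl hconst, Finset.sum_const, nsmul_eq_mul]
      change _ = walkProd (jumpWeight w) l₀ /
        (cyclicMultiplicity (routePartition i j l₀ : Cycle (Sym2 (List (Arc V (E ⊕ V))))) : ℝ)
      have hpos : (routePartition i j l₀).length ≠ 0 := by simpa using hne
      have hpos' : ((routePartition i j l₀).length : ℝ) ≠ 0 := by exact_mod_cast hpos
      have hμ : (cyclicMultiplicity (routePartition i j l₀ : Cycle (Sym2 (List (Arc V (E ⊕ V))))) : ℝ)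
          ≠ 0 := by
        intro h
        rw [Nat.cast_eq_zero.1 h, mul_zero] at hcard
        exact hpos hcard.symm
      have hcard' := congrArg (Nat.cast (R := ℝ)) hcard
      rw [Nat.cast_mul] at hcard'
      field_simp
      linear_combination walkProd (jumpWeight w) l₀ * hcard'
    · intro l hl l' hl' h
      exact isAlternating_eq_of_routePartition_eq hij ha hb ((hmem l).1 hl).1 ((hmem l').1 hl').1 h
  rw [routeSum, ← Finset.sum_congr rfl hterm, ← Finset.sum_biUnion hdisj]
  refine Finset.sum_congr ?_ fun _ _ => rfl
  ext l
  simp only [Finset.mem_biUnion, Set.Finite.mem_toFinset, fib, Finset.mem_filter,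
    mem_listsOfLength]
  constructor
  · rintro ⟨r, -, h1, h2, -⟩
    exact ⟨h1, h2⟩
  · rintro ⟨h1, h2⟩
    exact ⟨Quotient.mk _ ⟨l, h2⟩, h1, h1, h2, rfl⟩

end Words

/-! ### Generating functions of words -/

section WordSums

open Classical

variable {α : Type*} [Finite α]

/-- The words of `s` letters with total length `k`, the letters being the lists that satisfy
`Λ`. -/
noncomputable def words (Λ : List α → Prop) : ℕ → ℕ → Finset (List (List α))
  | 0, k => if k = 0 then {[]} else ∅
  | s + 1, k => (Finset.HasAntidiagonal.antidiagonal k).biUnion fun m =>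
      (((listsOfLength α m.1).filter Λ) ×ˢ words Λ s m.2).image fun x => x.1 :: x.2

theorem mem_words {Λ : List α → Prop} {s k : ℕ} {ps : List (List α)} :
    ps ∈ words Λ s k ↔ (∀ p ∈ ps, Λ p) ∧ ps.length = s ∧ ps.flatten.length = k := by
  induction s generalizing k ps with
  | zero =>
    rw [words]
    constructor
    · intro h
      split_ifs at h with hk
      · obtain rfl := Finset.mem_singleton.1 h
        simp [hk]
      · simp at h
    · rintro ⟨-, h1, rfl⟩
      obtain rfl := List.length_eq_zero_iff.1 h1
      simp
  | succ s ih =>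
    simp only [words, Finset.mem_biUnion, Finset.HasAntidiagonal.mem_antidiagonal, Finset.mem_image,
      Finset.mem_product, Finset.mem_filter, mem_listsOfLength, ih]
    constructor
    · rintro ⟨m, rfl, ⟨p, qs⟩, ⟨⟨h1, h2⟩, h3, h4, h5⟩, rfl⟩
      refine ⟨?_, by simp [h4], by simp only [List.flatten_cons, List.length_append]; rw [h1, h5]⟩
      rintro q (_ | ⟨_, hq⟩)
      · exact h2
      · exact h3 q hq
    · rintro ⟨h1, h2, rfl⟩
      rcases ps with _ | ⟨p, qs⟩
      · simp at h2
      · exact ⟨(p.length, qs.flatten.length), by simp, (p, qs),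
          ⟨⟨rfl, h1 p (by simp)⟩, fun q hq => h1 q (by simp [hq]), by simpa using h2, rfl⟩, rfl⟩

/-- The generating function of the letters. -/
noncomputable def letterSeries (Λ : List α → Prop) (f : List α → ℝ) : PowerSeries ℝ :=
  PowerSeries.mk fun m => ∑ p ∈ (listsOfLength α m).filter Λ, f p

theorem coeff_letterSeries_pow (Λ : List α → Prop) (f : List α → ℝ) (s k : ℕ) :
    PowerSeries.coeff k (letterSeries Λ f ^ s) = ∑ ps ∈ words Λ s k, (ps.map f).prod := by
  induction s generalizing k with
  | zero =>
    rw [pow_zero, PowerSeries.coeff_one, words]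
    split_ifs <;> simp
  | succ s ih =>
    rw [pow_succ', PowerSeries.coeff_mul, words, Finset.sum_biUnion]
    · refine Finset.sum_congr rfl fun m _ => ?_
      rw [Finset.sum_image, Finset.sum_product, ih, letterSeries, PowerSeries.coeff_mk,
        Finset.sum_mul_sum]
      · simp
      · rintro ⟨p, ps⟩ _ ⟨q, qs⟩ _ h
        simpa using h
    · intro m hm m' hm' hne
      rw [Function.onFun, Finset.disjoint_left]
      intro ps h1 h2
      simp only [Finset.mem_image, Finset.mem_product, Finset.mem_filter, mem_listsOfLength] at h1 h2
      obtain ⟨⟨p, qs⟩, ⟨⟨h3, -⟩, -⟩, rfl⟩ := h1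
      obtain ⟨⟨p', qs'⟩, ⟨⟨h3', -⟩, -⟩, h4⟩ := h2
      simp only [List.cons.injEq] at h4
      obtain ⟨rfl, -⟩ := h4
      have e1 := Finset.HasAntidiagonal.mem_antidiagonal.1 (Finset.mem_coe.1 hm)
      have e2 := Finset.HasAntidiagonal.mem_antidiagonal.1 (Finset.mem_coe.1 hm')
      simp only at h3 h3'
      exact hne (Prod.ext (by omega) (by omega))

end WordSums

/-! ### Closed minus open routes as powers of the letter series -/

section SignedRoutes

open Classical

variable {V E : Type*} {G : Graph V E} {i j : V} [Fintype V] [Fintype E]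

theorem sum_isAlternating_eq (hij : i ≠ j) (w : E → ℝ) {a b : V} (ha : a = i ∨ a = j)
    (hb : b = i ∨ b = j) {k : ℕ} (hk : k ≠ 0) :
    ∑ l ∈ (listsOfLength (Arc V (E ⊕ V)) k).filter (IsAlternating G i j a b),
        walkProd (jumpWeight w) l / (routePartition i j l).length =
      ∑ s ∈ Finset.Icc 1 k, ∑ ps ∈ words (IsLetter G i j) s k,
        if endVertex i j a ps = b then (ps.map (walkProd (jumpWeight w))).prod / s else 0 := by
  rw [Finset.sum_sigma']
  symm
  rw [← Finset.sum_filter]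
  refine Finset.sum_bij (fun x _ => (toChain i j a x.2).flatten) ?_ ?_ ?_ ?_
  · rintro ⟨s, ps⟩ h
    simp only [Finset.mem_filter, Finset.mem_sigma, mem_words] at h
    obtain ⟨⟨-, h1, -, h3⟩, h4⟩ := h
    rw [Finset.mem_filter, mem_listsOfLength, length_flatten_toChain]
    exact ⟨h3, (isAlternating_iff_exists_word hij ha hb).2 ⟨ps, h1, h4, rfl⟩⟩
  · rintro ⟨s, ps⟩ h ⟨s', ps'⟩ h' he
    simp only [Finset.mem_filter, Finset.mem_sigma, mem_words] at h h'
    obtain ⟨⟨-, h1, rfl, -⟩, -⟩ := h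
    obtain ⟨⟨-, h1', rfl, -⟩, -⟩ := h'
    have h5 := congrArg (routePartition i j) he
    simp only [routePartition_toChain hij h1 ha, routePartition_toChain hij h1' ha] at h5
    rw [map_injOn_of_injOn (pairOf_injOn (G := G) hij) h1 h1' h5]
  · intro l hl
    obtain ⟨hlk, hl⟩ := Finset.mem_filter.1 hl
    rw [mem_listsOfLength] at hlk
    obtain ⟨ps, h1, h2, rfl⟩ := (isAlternating_iff_exists_word hij ha hb).1 hl
    rw [length_flatten_toChain] at hlk
    refine ⟨⟨ps.length, ps⟩, ?_, rfl⟩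
    simp only [Finset.mem_filter, Finset.mem_sigma, mem_words, Finset.mem_Icc]
    refine ⟨⟨⟨?_, ?_⟩, h1, trivial, hlk⟩, h2⟩
    · rw [Nat.one_le_iff_ne_zero, Ne, List.length_eq_zero_iff]
      rintro rfl
      exact hk hlk.symm
    -- Letters are nonempty, so a word of total length k has at most k letters.
    · rw [← hlk, List.length_flatten]
      have : ps.length = (ps.map fun _ => 1).sum := by simp
      rw [this]
      refine List.sum_le_sum fun p hp => ?_
      exact List.length_pos_iff.2 ((h1 p hp).isPiece.ne_nil hij (Or.inr rfl))
  · rintro ⟨s, ps⟩ h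
    simp only [Finset.mem_filter, Finset.mem_sigma, mem_words] at h
    obtain ⟨⟨-, h1, rfl, -⟩, -⟩ := h
    simp only [walkProd_toChain, routePartition_toChain hij h1 ha, List.length_map]

/-- The two sums run over complementary sets of words, told apart by the sign, so their difference
is an unrestricted signed sum over all words. It does not depend on a. -/
theorem routeSum_sub_routeSum (hij : i ≠ j) (w : E → ℝ) {a : V} (ha : a = i ∨ a = j) {k : ℕ}
    (hk : k ≠ 0) :
    routeSum G w i j a a k - routeSum G w i j a (Equiv.swap i j a) k =
      ∑ s ∈ Finset.Icc 1 k, (1 / s : ℝ) * PowerSeries.coeff k (letterSeries (IsLetter G i j)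
        (fun p => letterSign j p * walkProd (jumpWeight w) p) ^ s) := by
  rw [routeSum_eq hij w ha ha hk, routeSum_eq hij w ha (swap_mem ha) hk,
    sum_isAlternating_eq hij w ha ha hk, sum_isAlternating_eq hij w ha (swap_mem ha) hk,
    ← Finset.sum_sub_distrib]
  refine Finset.sum_congr rfl fun s _ => ?_
  rw [coeff_letterSeries_pow, Finset.mul_sum, ← Finset.sum_sub_distrib]
  refine Finset.sum_congr rfl fun ps _ => ?_
  rw [List.prod_map_mul]
  have hne := swap_ne hij ha
  rcases endVertex_eq (i := i) (j := j) a ps with ⟨h1, h2⟩ | ⟨h1, h2⟩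
  · rw [h1, h2, if_pos rfl, if_neg hne.symm]
    ring
  · rw [h1, h2, if_neg hne, if_pos rfl]
    ring

end SignedRoutes

/-! ### The letter series as a first-return series; the trace formula -/

section LetterSeries

variable {V E : Type*} {G : Graph V E} {i j : V} [Fintype V] [Fintype E]

theorem arcMatrix_addJumps (w : E → ℝ) (P : V → Prop) :
    arcMatrix (addJumps G i j) (jumpWeight w) (fun a => a.edge.isLeft = true ∧ P a.tgt) =
      arcMatrix G w fun a => P a.tgt := by
  ext u v
  simp only [arcMatrix, Matrix.of_apply, Fintype.sum_sum_type, jumpWeight, Sum.elim_inl]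
  rw [Finset.sum_eq_zero (s := (Finset.univ : Finset V)), add_zero]
  · refine Finset.sum_congr rfl fun e _ => ?_
    by_cases h : G.IsLink e u v ∧ P v
    · rw [if_pos h, if_pos ⟨h.1, rfl, h.2⟩]
    · rw [if_neg h, if_neg fun h' => h ⟨h'.1, h'.2.2⟩]
  · intro x _
    rw [if_neg]
    rintro ⟨-, h, -⟩
    simp at h

variable [DecidableEq V]

theorem sum_listsOfLength_succ' {α : Type*} [Fintype α] (k : ℕ) (f : List α → ℝ) :
    ∑ l ∈ listsOfLength α (k + 1), f l = ∑ a, ∑ l ∈ listsOfLength α k, f (l ++ [a]) := by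
  have hrev : ∀ (m : ℕ) (g : List α → ℝ),
      ∑ l ∈ listsOfLength α m, g l = ∑ l ∈ listsOfLength α m, g l.reverse := by
    intro m g
    refine Finset.sum_bij' (fun l _ => l.reverse) (fun l _ => l.reverse) ?_ ?_ ?_ ?_ ?_ <;> simp
  rw [hrev, sum_listsOfLength_succ]
  refine Finset.sum_congr rfl fun a _ => ?_
  rw [hrev k fun l => f (l ++ [a])]
  simp

theorem arcMatrix_tgt_ne (w : E → ℝ) (y : V) :
    arcMatrix G w (fun a => a.tgt ≠ y) = (adjMatrix G w).updateCol y 0 := by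
  ext u v
  rw [adjMatrix_eq_arcMatrix, Matrix.updateCol_apply]
  simp only [arcMatrix, Matrix.of_apply]
  split_ifs with h
  · exact Finset.sum_eq_zero fun e _ => if_neg fun h' => h'.2 h
  · refine Finset.sum_congr rfl fun e _ => ?_
    by_cases h' : G.IsLink e u v
    · rw [if_pos ⟨h', h⟩, if_pos ⟨h', trivial⟩]
    · rw [if_neg fun h'' => h' h''.1, if_neg fun h'' => h' h''.1]

theorem arcMatrix_tgt_ne_and (w : E → ℝ) (x y : V) :
    arcMatrix G w (fun a => a.tgt ≠ x ∧ a.tgt ≠ y) =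
      ((adjMatrix G w).updateCol x 0).updateCol y 0 := by
  ext u v
  rw [← arcMatrix_tgt_ne, Matrix.updateCol_apply]
  simp only [arcMatrix, Matrix.of_apply]
  split_ifs with h
  · exact Finset.sum_eq_zero fun e _ => if_neg fun h' => h'.2.2 h
  · refine Finset.sum_congr rfl fun e _ => ?_
    by_cases h' : G.IsLink e u v ∧ v ≠ x
    · rw [if_pos ⟨h'.1, h'.2, h⟩, if_pos h']
    · rw [if_neg fun h'' => h' ⟨h''.1, h''.2.1⟩, if_neg h']

-- Removing the last arc, which enters i, leaves a walk without jumps whose targets all avoid i and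
-- j.
open Classical in
theorem sum_isHit (hV : G.vertexSet = Set.univ) (w : E → ℝ) (m : ℕ) :
    ∑ p ∈ listsOfLength (Arc V (E ⊕ V)) (m + 1),
        (if IsHit G i j j p then walkProd (jumpWeight w) p else 0) =
      ((((adjMatrix G w).updateCol i 0).updateCol j 0) ^ m * adjMatrix G w) j i := by
  have hV' : (addJumps G i j).vertexSet = Set.univ := by
    simp [addJumps, hV]
  rw [sum_listsOfLength_succ', sum_arc, Matrix.mul_apply]
  refine Finset.sum_congr rfl fun u _ => ?_
  rw [Finset.sum_eq_single i]
  · rw [← arcMatrix_tgt_ne_and, ← arcMatrix_addJumps (i := i) (j := j) w fun v => v ≠ i ∧ v ≠ j,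
      ← sum_walkProd hV', Fintype.sum_sum_type, adjMatrix, Matrix.of_apply, Finset.mul_sum,
      Finset.sum_eq_zero (s := (Finset.univ : Finset V)), add_zero]
    · refine Finset.sum_congr rfl fun e _ => ?_
      rw [Finset.sum_mul]
      refine Finset.sum_congr rfl fun q _ => ?_
      have hiff : IsHit G i j j (q ++ [⟨u, Sum.inl e, i⟩]) ↔
          (IsWalk (addJumps G i j) j q u ∧
            ∀ a ∈ q, a.edge.isLeft = true ∧ a.tgt ≠ i ∧ a.tgt ≠ j) ∧ G.IsLink e u i := by
        rw [IsHit, isWalk_concat, List.dropLast_concat, swap_classical_right]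
        constructor
        · rintro ⟨⟨h1, h2, -⟩, h3, h4⟩
          exact ⟨⟨h1, fun a ha => ⟨h3 a (by simp [ha]), h4 a ha⟩⟩, h2⟩
        · rintro ⟨⟨h1, h2⟩, h3⟩
          refine ⟨⟨h1, h3, rfl⟩, fun a ha => ?_, fun a ha => (h2 a ha).2⟩
          rcases List.mem_append.1 ha with ha | ha
          · exact (h2 a ha).1
          · rw [List.mem_singleton.1 ha]; rfl
      by_cases h1 : IsWalk (addJumps G i j) j q u ∧
            ∀ a ∈ q, a.edge.isLeft = true ∧ a.tgt ≠ i ∧ a.tgt ≠ j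
      · by_cases h2 : G.IsLink e u i
        · rw [if_pos (hiff.2 ⟨h1, h2⟩), if_pos h1, if_pos h2]
          simp [walkProd, jumpWeight]
        · rw [if_neg fun h => h2 (hiff.1 h).2, if_neg h2, mul_zero]
      · rw [if_neg fun h => h1 (hiff.1 h).1, if_neg h1, zero_mul]
    · intro x _
      refine Finset.sum_eq_zero fun q _ => if_neg fun h => ?_
      have := h.2.1 ⟨u, Sum.inr x, i⟩ (by simp)
      simp at this
  · intro v _ hv
    refine Finset.sum_eq_zero fun e _ => Finset.sum_eq_zero fun q _ => if_neg fun h => ?_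
    have := (isWalk_concat.1 h.1).2.2
    rw [swap_classical_right] at this
    exact hv this
  · simp

theorem sum_ne_eq {f : V → ℝ} (hf : f i = 0) : ∑ v : {v // v ≠ i}, f v = ∑ v, f v := by
  rw [← Finset.sum_erase Finset.univ hf]
  exact (Finset.sum_subtype (Finset.univ.erase i) (by simp) f).symm

theorem pow_updateCol_zero_apply (M : Matrix V V ℝ) (y : V) (m : ℕ) (u : V) :
    ((M.updateCol y 0) ^ m) u y = if m = 0 ∧ u = y then 1 else 0 := by
  rcases m with _ | m
  · simp [Matrix.one_apply]
  · rw [pow_succ, Matrix.mul_apply]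
    simp

/-- Only column j was altered in the reduced matrix, and it is zeroed here. Index i drops out of the
products because column i is zero on the right. -/
theorem reducedMatrix_updateCol_pow (M : Matrix V V ℝ) (hij : i ≠ j) (m : ℕ) (u v : {v // v ≠ i}) :
    (((reducedMatrix M i j).updateCol ⟨j, hij.symm⟩ 0) ^ m) u v =
      (((M.updateCol i 0).updateCol j 0) ^ m) u v := by
  induction m generalizing v with
  | zero => simp [Matrix.one_apply, Subtype.ext_iff]
  | succ m ih =>
    rw [pow_succ, pow_succ, Matrix.mul_apply, Matrix.mul_apply]
    have hzero : (((M.updateCol i 0).updateCol j 0) ^ m) u i = 0 := by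
      rw [Matrix.updateCol_comm _ hij, pow_updateCol_zero_apply, if_neg fun h => u.2 h.2]
    rw [← sum_ne_eq (i := i) (by rw [hzero, zero_mul])]
    refine Finset.sum_congr rfl fun x _ => ?_
    rw [ih]
    congr 1
    rw [Matrix.updateCol_apply, Matrix.updateCol_apply, Matrix.updateCol_apply, if_neg v.2]
    by_cases h : v.1 = j
    · rw [if_pos h, if_pos (Subtype.ext h)]
      rfl
    · rw [if_neg h, if_neg fun h' => h (congrArg Subtype.val h')]
      simp [reducedMatrix, h]

theorem trace_reducedMatrix_updateCol_pow (M : Matrix V V ℝ) (hij : i ≠ j) {k : ℕ} (hk : k ≠ 0) :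
    (((reducedMatrix M i j).updateCol ⟨j, hij.symm⟩ 0) ^ k).trace =
      (((M.updateCol i 0).updateCol j 0) ^ k).trace := by
  simp only [Matrix.trace, Matrix.diag_apply, reducedMatrix_updateCol_pow M hij]
  refine sum_ne_eq (i := i) (f := fun u => (((M.updateCol i 0).updateCol j 0) ^ k) u u) ?_
  rw [Matrix.updateCol_comm _ hij, pow_updateCol_zero_apply, if_neg fun h => hk h.1]

/-- Column j of the reduced matrix has entries δ_uj - M_ui: the δ produces the jump, present only
for m = 0, and the rest produces the hitting walks with sign -. -/
theorem firstReturn_reducedMatrix (M : Matrix V V ℝ) (hij : i ≠ j) (m : ℕ) :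
    (((reducedMatrix M i j).updateCol ⟨j, hij.symm⟩ 0) ^ m * reducedMatrix M i j)
        ⟨j, hij.symm⟩ ⟨j, hij.symm⟩ =
      (if m = 0 then 1 else 0) - (((M.updateCol i 0).updateCol j 0) ^ m * M) j i := by
  set K := (M.updateCol i 0).updateCol j 0 with hK
  have hKi : (K ^ m) j i = 0 := by
    rw [hK, Matrix.updateCol_comm _ hij, pow_updateCol_zero_apply,
      if_neg fun h => hij h.2.symm]
  rw [Matrix.mul_apply]
  simp only [reducedMatrix_updateCol_pow M hij]
  have h1 : ∀ x : {v // v ≠ i}, (K ^ m) j x * reducedMatrix M i j x ⟨j, hij.symm⟩ =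
      (fun x : V => (K ^ m) j x * (if x = j then 1 else 0) - (K ^ m) j x * M x i) x := by
    intro x
    by_cases h : x.1 = j
    · simp [reducedMatrix, h]; ring
    · simp [reducedMatrix, h]
  rw [Finset.sum_congr rfl fun x _ => h1 x]
  refine (sum_ne_eq (i := i)
    (f := fun x => (K ^ m) j x * (if x = j then 1 else 0) - (K ^ m) j x * M x i)
    (by simp [hKi])).trans ?_
  rw [Finset.sum_sub_distrib, Matrix.mul_apply]
  simp [hK, pow_updateCol_zero_apply]

theorem letterSeries_eq_firstReturnSeries (hV : G.vertexSet = Set.univ) (hij : i ≠ j)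
    (w : E → ℝ) :
    letterSeries (IsLetter G i j) (fun p => letterSign j p * walkProd (jumpWeight w) p) =
      firstReturnSeries (reducedMatrix (adjMatrix G w) i j) ⟨j, hij.symm⟩ := by
  classical
  ext m
  rw [letterSeries, firstReturnSeries, PowerSeries.coeff_mk, PowerSeries.coeff_mk]
  rcases m with _ | m
  · rw [if_pos rfl]
    refine Finset.sum_eq_zero fun p hp => ?_
    obtain ⟨h1, h2⟩ := Finset.mem_filter.1 hp
    rw [mem_listsOfLength, List.length_eq_zero_iff] at h1
    exact absurd h1 (h2.isPiece.ne_nil hij (Or.inr rfl))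
  · rw [if_neg m.succ_ne_zero, Nat.add_sub_cancel, firstReturn_reducedMatrix _ hij, ← sum_isHit hV,
      Finset.sum_filter]
    have h1 : ∑ p ∈ listsOfLength (Arc V (E ⊕ V)) (m + 1),
        (if p = [jump E j] then (1 : ℝ) else 0) = if m = 0 then 1 else 0 := by
      rw [Finset.sum_ite_eq']
      simp
    rw [← h1, ← Finset.sum_sub_distrib]
    refine Finset.sum_congr rfl fun p _ => ?_
    by_cases hp : p = [jump E j]
    · have hnot : ¬ IsHit G i j j p := by
        rintro ⟨-, h2, -⟩
        have := h2 (jump E j) (by simp [hp])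
        simp [jump] at this
      rw [if_pos ⟨j, Or.inl ⟨hp, rfl⟩⟩, if_pos hp, if_neg hnot, letterSign, if_pos hp, hp]
      simp [walkProd, jumpWeight, jump]
    · by_cases hh : IsHit G i j j p
      · rw [if_pos ⟨_, Or.inr ⟨hh, rfl⟩⟩, if_neg hp, if_pos hh, letterSign, if_neg hp]
        ring
      · rw [if_neg, if_neg hp, if_neg hh, sub_zero]
        rintro ⟨c, h | h⟩
        · exact hp h.1
        · exact hh h.1

/-- The two route differences give 2(tr N^k - tr K^k), and the circuits remove tr P^k + tr Q^k - 2
tr K^k, so the traces of K cancel. -/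
theorem mul_figureSum (hV : G.vertexSet = Set.univ) (hij : i ≠ j) (w : E → ℝ) {k : ℕ}
    (hk : k ≠ 0) :
    k * figureSum G w i j k = 2 * (reducedMatrix (adjMatrix G w) i j ^ k).trace -
      ((adjMatrix G w).updateCol i 0 ^ k).trace - ((adjMatrix G w).updateCol j 0 ^ k).trace := by
  have h1 := mul_circuitSum hV w i j hk
  have h2 := mul_circuitSum hV w j i hk
  rw [arcMatrix_tgt_ne, arcMatrix_tgt_ne_and] at h1 h2
  rw [Matrix.updateCol_comm _ hij.symm] at h2
  have h3 := routeSum_sub_routeSum (G := G) hij w (a := i) (Or.inl rfl) hk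
  have h4 := routeSum_sub_routeSum (G := G) hij w (a := j) (Or.inr rfl) hk
  rw [letterSeries_eq_firstReturnSeries hV hij] at h3 h4
  rw [swap_classical_left] at h3
  rw [swap_classical_right] at h4
  have h5 := sum_coeff_firstReturnSeries_pow (reducedMatrix (adjMatrix G w) i j) ⟨j, hij.symm⟩ k
  rw [trace_reducedMatrix_updateCol_pow _ hij hk] at h5
  rw [figureSum]
  linear_combination 2 * h5 - h1 - h2 + k * h3 + k * h4

end LetterSeries

/-! ### Convergence of the figure series and its value -/

section Convergence

variable {V E : Type*} {G : Graph V E} {i j : V} [Fintype V] [DecidableEq V] [Fintype E]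

theorem summable_trace_div {ι : Type*} [Fintype ι] [DecidableEq ι] {M : Matrix ι ι ℝ}
    (h : ∀ u, Summable fun k : ℕ => |(M ^ k) u u|) :
    Summable fun k : ℕ => (M ^ k).trace / k := by
  refine Summable.of_norm_bounded (g := fun k => ∑ u, |(M ^ k) u u|)
    (summable_sum fun u _ => h u) fun k => ?_
  rw [Real.norm_eq_abs, abs_div, Nat.abs_cast]
  refine le_trans ?_ (Finset.abs_sum_le_sum_abs _ _)
  rcases Nat.eq_zero_or_pos k with rfl | hk
  · simp
  · exact div_le_self (abs_nonneg _) (by exact_mod_cast hk)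

theorem pow_entry_le_pow_entry {ι : Type*} [Fintype ι] [DecidableEq ι] {M K : Matrix ι ι ℝ}
    (h0 : ∀ u v, 0 ≤ K u v) (h : ∀ u v, K u v ≤ M u v) (k : ℕ) (u v : ι) :
    0 ≤ (K ^ k) u v ∧ (K ^ k) u v ≤ (M ^ k) u v := by
  induction k generalizing v with
  | zero =>
    rw [pow_zero, pow_zero, Matrix.one_apply]
    split_ifs <;> norm_num
  | succ k ih =>
    rw [pow_succ, pow_succ, Matrix.mul_apply, Matrix.mul_apply]
    exact ⟨Finset.sum_nonneg fun x _ => mul_nonneg (ih x).1 (h0 x v),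
      Finset.sum_le_sum fun x _ => mul_le_mul (ih x).2 (h x v) (h0 x v)
        ((ih x).1.trans (ih x).2)⟩

/-- With nonnegative entries, zeroing a column only decreases the entries of the powers, so no
spectral bound for P or Q is needed. -/
theorem summable_trace_updateCol {w : E → ℝ} (hw : ∀ e ∈ G.edgeSet, 0 < w e)
    (hM : specRadius (adjMatrix G w) < 1) (y : V) :
    Summable fun k : ℕ => ((adjMatrix G w).updateCol y 0 ^ k).trace / k := by
  refine summable_trace_div fun u => ?_
  have hle := pow_entry_le_pow_entry (M := adjMatrix G w) (K := (adjMatrix G w).updateCol y 0)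
    (fun u v => by
      rw [Matrix.updateCol_apply]
      split_ifs
      · exact le_rfl
      · exact adjMatrix_nonneg hw u v)
    (fun u v => by
      rw [Matrix.updateCol_apply]
      split_ifs
      · exact adjMatrix_nonneg hw u v
      · exact le_rfl)
  refine (summable_abs_pow_entry_of_specRadius_lt_one _ hM u u).of_nonneg_of_le
    (fun _ => abs_nonneg _) fun k => ?_
  rw [abs_of_nonneg (hle k u u).1]
  exact (hle k u u).2.trans (le_abs_self _)

theorem summable_figureSum (hV : G.vertexSet = Set.univ) (hij : i ≠ j) {w : E → ℝ}
    (hw : ∀ e ∈ G.edgeSet, 0 < w e) (hM : specRadius (adjMatrix G w) < 1)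
    (hN : specRadius (reducedMatrix (adjMatrix G w) i j) < 1) :
    Summable fun k => figureSum G w i j k := by
  have h := (((summable_trace_div fun u =>
    summable_abs_pow_entry_of_specRadius_lt_one _ hN u u).mul_left 2).sub
      (summable_trace_updateCol hw hM i)).sub (summable_trace_updateCol hw hM j)
  rw [← summable_nat_add_iff 1] at h ⊢
  refine h.congr fun k => ?_
  have hk : ((k + 1 : ℕ) : ℝ) ≠ 0 := by positivity
  rw [← mul_right_inj' hk, mul_figureSum hV hij w k.succ_ne_zero]
  field_simp

/-- The Abel argument uses series starting at 0. Setting that term to 0 avoids evaluating the figure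
sum there, where the empty alternating walk is a route. -/
theorem sum_Icc_eq_sum_range (f : ℕ → ℝ) (n : ℕ) :
    ∑ k ∈ Finset.Icc 1 n, f k = ∑ k ∈ Finset.range (n + 1), if k = 0 then 0 else f k := by
  rw [Finset.sum_range_succ', if_pos rfl, add_zero, ← Finset.Ico_add_one_right_eq_Icc,
    Finset.sum_Ico_eq_sum_range]
  simp [add_comm]

theorem eq_walkDist_of_tendsto (hV : G.vertexSet = Set.univ) (hG : IsConnected G) {w : E → ℝ}
    {t : ℝ} (hw : ∀ e ∈ G.edgeSet, 0 < t * w e)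
    (hM : specRadius (adjMatrix G fun e => t * w e) < 1) (hij : i ≠ j) {d : ℝ}
    (hd : Tendsto (fun N : ℕ => (1 / 2) * ∑ k ∈ Finset.Icc 1 N,
      figureSum G (fun e => t * w e) i j k) atTop (𝓝 d)) :
    d = walkDist G w t i j := by
  have hS : Tendsto (fun N : ℕ => ∑ k ∈ Finset.range N,
      if k = 0 then 0 else figureSum G (fun e => t * w e) i j k) atTop (𝓝 (2 * d)) := by
    rw [← tendsto_add_atTop_iff_nat 1]
    refine (hd.const_mul 2).congr fun N => ?_
    rw [sum_Icc_eq_sum_range]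
    ring
  have h := exp_mul_det_sq_of_tendsto
    (reducedMatrix (adjMatrix G fun e => t * w e) i j)
    ((adjMatrix G fun e => t * w e).updateCol i 0)
    ((adjMatrix G fun e => t * w e).updateCol j 0) (by simp)
    (fun k hk => by rw [if_neg hk, mul_figureSum hV hij _ hk]) hS
  rw [← half_eq_walkDist hV hG hw hM hij h]
  ring

end Convergence

end WalkDist

/-! ### The main theorem -/

theorem mainTheorem1 {V E : Type*} [Fintype V] [DecidableEq V] [Fintype E]
    (G : Graph V E) (hV : G.vertexSet = Set.univ) (hG : WalkDist.IsConnected G)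
    (w : E → ℝ) (hw : ∀ e ∈ G.edgeSet, 0 < w e)
    (i j : V) (hij : i ≠ j)
    (t : ℝ) (ht : 0 < t)
    (htρ : ENNReal.ofReal t < (WalkDist.specRadius (WalkDist.adjMatrix G w))⁻¹) :
    (WalkDist.specRadius (WalkDist.reducedMatrix (t • WalkDist.adjMatrix G w) i j) < 1 →
      Tendsto
        (fun N : ℕ => (1 / 2) * ∑ k ∈ Finset.Icc 1 N,
          WalkDist.figureSum G (fun e => t * w e) i j k)
        atTop (𝓝 (WalkDist.walkDist G w t i j))) ∧
    (∀ d : ℝ,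
      Tendsto
        (fun N : ℕ => (1 / 2) * ∑ k ∈ Finset.Icc 1 N,
          WalkDist.figureSum G (fun e => t * w e) i j k)
        atTop (𝓝 d) →
      d = WalkDist.walkDist G w t i j) := by
  have hw' : ∀ e ∈ G.edgeSet, 0 < t * w e := fun e he => mul_pos ht (hw e he)
  have hM : WalkDist.specRadius (WalkDist.adjMatrix G fun e => t * w e) < 1 := by
    rw [WalkDist.adjMatrix_smul]
    exact WalkDist.specRadius_smul_lt_one _ ht htρ
  have hlim := fun d => WalkDist.eq_walkDist_of_tendsto (d := d) hV hG hw' hM hij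
  refine ⟨fun hN => ?_, hlim⟩
  rw [← WalkDist.adjMatrix_smul] at hN
  have hsum := (WalkDist.summable_figureSum hV hij hw' hM hN)
  have hsum0 : Summable fun k =>
      if k = 0 then 0 else WalkDist.figureSum G (fun e => t * w e) i j k := by
    rw [← summable_nat_add_iff 1] at hsum ⊢
    simpa using hsum
  have hS : Tendsto (fun N : ℕ => (1 / 2) * ∑ k ∈ Finset.Icc 1 N,
      WalkDist.figureSum G (fun e => t * w e) i j k) atTop (𝓝 _) :=
    (((tendsto_add_atTop_iff_nat 1).2 hsum0.hasSum.tendsto_sum_nat).const_mul (1 / 2)).congr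
      fun N => by rw [WalkDist.sum_Icc_eq_sum_range]
  -- Summability gives some limit, and the second half of the theorem identifies it.
  rw [hlim _ hS] at hS
  exact hS
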